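/- Let $P=-i\,d/dx$ and $Q$ (multiplication by $x$) be the momentum and position operators on $L^2(\mathbb R)$, with domain the space $\mathcal D$ of Schwartz functions. For $a,b\in\mathbb R$ and $c\in\mathbb R\setminus\{0\}$ let $R(a,b,c)=(ic+aP+bQ)^{-1}$ be the inverse of $ic+\overline{(aP+bQ)|_{\mathcal D}}$ (bar: closure), and let $\mathcal R$ be the C*-algebra of bounded operators on $L^2(\mathbb R)$ generated by all the $R(a,b,c)$. For $m>0$ let $H_m=(P^2+m^2)^{1/2}$; likewise $(ic+Q+tP(P^2+m^2)^{-1/2})^{-1}$ is the inverse of $ic$ plus the closure of $Q+tP(P^2+m^2)^{-1/2}$ on $\mathcal D$. Bounded functions of $P$ are defined by multiplication in momentum space. For $\delta>0$ let $D(\delta)$ be the unitary dilation $(D(\delta)f)(x)=\delta^{-1/2}f(x/\delta)$. All limits are in the strong operator topology. 1. For all $a,b\in\mathbb R$, $c\neq0$, the operator $R(a,b,c)$ exists as an everywhere defined bounded two-sided inverse, and $$\lim_{\delta\to\infty}D(\delta)\,R(a,b,c)\,D(\delta)^{-1}=\begin{cases}(ic)^{-1}1,& a=0,\\ 0,& a\neq0.\end{cases}$$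 For every $A\in\mathcal R$ the limit $\lim_{\delta\to\infty}D(\delta)AD(\delta)^{-1}$ exists and is a scalar multiple of $1$. 2. For all $m>0$, $t\in\mathbb R$, $c\neq0$, the operator $(ic+Q+tP(P^2+m^2)^{-1/2})^{-1}$ exists as an everywhere defined bounded two-sided inverse, the bounded operator $ic+tP/|P|$ is invertible, and $$\lim_{\delta\to\infty}D(\delta)\,(ic+Q+tP(P^2+m^2)^{-1/2})^{-1}D(\delta)^{-1}=(ic+tP/|P|)^{-1}.$$ If $t\neq0$, this limit is not a scalar multiple of $1$. 3. For all $m>0$, $t\in\mathbb R$, $c\neq0$, $$e^{itH_m}(ic+Q)^{-1}e^{-itH_m}=(ic+Q+tP(P^2+m^2)^{-1/2})^{-1},$$ and for $t\neq0$ this operator is not in $\mathcal R$. Hence for every $m>0$ and $t\neq0$ there is an $A\in\mathcal R$ with $e^{itH_m}Ae^{-itH_m}\notin\mathcal R$. -/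

import Mathlib

open MeasureTheory Filter Topology SchwartzMap FourierTransform

namespace ResolventAlgebra

noncomputable section

/-- The Hilbert space `L²(ℝ)` of the Schrödinger representation (one degree of freedom). -/
abbrev H : Type := Lp ℂ 2 (volume : Measure ℝ)

/-! ### Position and momentum on Schwartz functions -/

/-- The domain `𝓓 ⊆ L²(ℝ)`: the (classes of) Schwartz test functions. -/
def schwartzDomain : Submodule ℂ H :=
  LinearMap.range (toLpCLM ℂ ℂ 2 (volume : Measure ℝ)).toLinearMap

/-- Schwartz functions as a subspace of `L²(ℝ)`. -/
def schwartzEquiv : 𝓢(ℝ, ℂ) ≃ₗ[ℂ] schwartzDomain :=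
  LinearEquiv.ofInjective (toLpCLM ℂ ℂ 2 (volume : Measure ℝ)).toLinearMap
    (injective_toLp 2 (volume : Measure ℝ))

/-- The operator in `L²(ℝ)` with domain `𝓓` given by a linear map of the Schwartz space. -/
def onSchwartz (A : 𝓢(ℝ, ℂ) →L[ℂ] 𝓢(ℝ, ℂ)) : H →ₗ.[ℂ] H where
  domain := schwartzDomain
  toFun := (toLpCLM ℂ ℂ 2 (volume : Measure ℝ)).toLinearMap ∘ₗ A.toLinearMap ∘ₗ
    schwartzEquiv.symm.toLinearMap

/-- The position operator `Q`, `(Q f)(x) = x f(x)`, on `𝓓`. -/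
def opQ : H →ₗ.[ℂ] H :=
  onSchwartz (smulLeftCLM ℂ (fun x : ℝ => (x : ℂ)))

/-- The momentum operator `P`, `(P f)(x) = -i f'(x)`, on `𝓓`. -/
def opP : H →ₗ.[ℂ] H :=
  onSchwartz (-Complex.I • derivCLM ℂ ℂ)

/-! ### Inverses of unbounded operators, resolvents, and the resolvent algebra -/

/-- `R` is the everywhere defined, bounded, two-sided inverse of the unbounded operator `S`. -/
def IsBoundedInverse (S : H →ₗ.[ℂ] H) (R : H →L[ℂ] H) : Prop :=
  (∀ ψ : S.domain, R (S ψ) = ψ) ∧ ∀ φ : H, ∃ h : R φ ∈ S.domain, S ⟨R φ, h⟩ = φ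

open scoped Classical in
/-- The bounded inverse of an unbounded operator (`0` if there is none). -/
def boundedInverse (S : H →ₗ.[ℂ] H) : H →L[ℂ] H :=
  if h : ∃ R, IsBoundedInverse S R then h.choose else 0

/-- `i c + T̄`, where `T̄` is the closure of `T`. -/
def shiftedClosure (c : ℝ) (T : H →ₗ.[ℂ] H) : H →ₗ.[ℂ] H :=
  ((Complex.I * (c : ℂ)) • (LinearMap.id : H →ₗ[ℂ] H)) +ᵥ T.closure

/-- `a P + b Q` on `𝓓`. -/
def linComb (a b : ℝ) : H →ₗ.[ℂ] H := (a : ℂ) • opP + (b : ℂ) • opQ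

/-- The basic resolvent `R(a, b, c) = (i c + a P + b Q)⁻¹`. -/
def basicResolvent (a b c : ℝ) : H →L[ℂ] H :=
  boundedInverse (shiftedClosure c (linComb a b))

/-- The resolvent algebra: the C*-subalgebra of `B(L²(ℝ))` generated by all `R(a, b, c)` with
`a, b ∈ ℝ` and `c ∈ ℝ \ {0}`. (It is unital, as `R(0, 0, c) = (i c)⁻¹ 1`.) -/
def resolventAlgebra : StarSubalgebra ℂ (H →L[ℂ] H) :=
  (StarAlgebra.adjoin ℂ
    {R : H →L[ℂ] H | ∃ a b c : ℝ, c ≠ 0 ∧ R = basicResolvent a b c}).topologicalClosure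

/-! ### Bounded functions of the momentum operator -/

/-- Multiplication by an essentially bounded function `g` on `L²(ℝ)`. -/
def mulOp (g : ℝ → ℂ) (hg : MemLp g ⊤ (volume : Measure ℝ)) : H →L[ℂ] H :=
  (ContinuousLinearMap.mul ℂ ℂ).holderL (volume : Measure ℝ) ⊤ 2 2 (hg.toLp g)

theorem memLp_scaled {g : ℝ → ℂ} (hg : Measurable g) {C : ℝ} (hC : ∀ p, ‖g p‖ ≤ C) :
    MemLp (fun ξ : ℝ => g (2 * Real.pi * ξ)) ⊤ (volume : Measure ℝ) :=
  memLp_top_of_bound (hg.comp (measurable_const_mul _)).aestronglyMeasurable C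
    (Eventually.of_forall fun _ => hC _)

/-- The bounded function `g(P)` of the momentum operator: in momentum space it is multiplication
by `g(p)`. (With the Fourier transform `∫ e^{-2πixξ} f(x) dx` used here, `P = -i d/dx` is
multiplication by `p = 2πξ`.) -/
def funP (g : ℝ → ℂ) (hg : Measurable g) {C : ℝ} (hC : ∀ p, ‖g p‖ ≤ C) : H →L[ℂ] H :=
  (Lp.fourierTransformₗᵢ ℝ ℂ).symm.toContinuousLinearEquiv.toContinuousLinearMap ∘L
    mulOp (fun ξ => g (2 * Real.pi * ξ)) (memLp_scaled hg hC) ∘L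
    (Lp.fourierTransformₗᵢ ℝ ℂ).toContinuousLinearEquiv.toContinuousLinearMap

theorem norm_velocity_le (m p : ℝ) : ‖((p / Real.sqrt (p ^ 2 + m ^ 2) : ℝ) : ℂ)‖ ≤ 1 := by
  rw [Complex.norm_real, Real.norm_eq_abs, abs_div, abs_of_nonneg (Real.sqrt_nonneg _)]
  exact div_le_one_of_le₀ (Real.abs_le_sqrt (by nlinarith [sq_nonneg m])) (Real.sqrt_nonneg _)

/-- The relativistic velocity `P (P² + m²)^{-1/2}`. -/
def velocity (m : ℝ) : H →L[ℂ] H :=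
  funP (fun p => ((p / Real.sqrt (p ^ 2 + m ^ 2) : ℝ) : ℂ)) (by fun_prop) (norm_velocity_le m)

theorem norm_signum_le (p : ℝ) : ‖((p / |p| : ℝ) : ℂ)‖ ≤ 1 := by
  rw [Complex.norm_real, Real.norm_eq_abs, abs_div, abs_abs]
  exact div_self_le_one _

/-- `P / |P|`. -/
def signP : H →L[ℂ] H :=
  funP (fun p => ((p / |p| : ℝ) : ℂ)) (by fun_prop) norm_signum_le

theorem norm_phase_le (t m p : ℝ) :
    ‖Complex.exp (((t * Real.sqrt (p ^ 2 + m ^ 2) : ℝ) : ℂ) * Complex.I)‖ ≤ 1 :=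
  (Complex.norm_exp_ofReal_mul_I _).le

/-- `e^{i t H_m}` for the relativistic free Hamiltonian `H_m = (P² + m²)^{1/2}`. -/
def relEvolution (m t : ℝ) : H →L[ℂ] H :=
  funP (fun p => Complex.exp (((t * Real.sqrt (p ^ 2 + m ^ 2) : ℝ) : ℂ) * Complex.I))
    (by fun_prop) (norm_phase_le t m)

/-- `Q + t P (P² + m²)^{-1/2}` on `𝓓`. -/
def boostedQ (m t : ℝ) : H →ₗ.[ℂ] H :=
  ((t : ℂ) • (velocity m).toLinearMap) +ᵥ opQ

/-- `(i c + Q + t P (P² + m²)^{-1/2})⁻¹`. -/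
def evolvedResolvent (m t c : ℝ) : H →L[ℂ] H :=
  boundedInverse (shiftedClosure c (boostedQ m t))

/-- `i c + t P / |P|`, a bounded operator. -/
def limitOp (t c : ℝ) : H →L[ℂ] H :=
  (Complex.I * (c : ℂ)) • (1 : H →L[ℂ] H) + (t : ℂ) • signP

/-! ### Dilations -/

theorem memLp_dilation {δ : ℝ} (hδ : 0 < δ) (f : H) :
    MemLp (fun x : ℝ => f (δ⁻¹ * x)) 2 (volume : Measure ℝ) := by
  have h0 : δ⁻¹ ≠ 0 := (inv_pos.2 hδ).ne'
  have hf : MemLp f 2 (Measure.map (fun x : ℝ => δ⁻¹ * x) volume) := by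
    rw [Real.map_volume_mul_left h0]
    exact (Lp.memLp f).smul_measure ENNReal.ofReal_ne_top
  exact hf.comp_of_map (measurable_const_mul _).aemeasurable

theorem ae_dilation {δ : ℝ} (hδ : 0 < δ) {p : ℝ → Prop} (h : ∀ᵐ x ∂(volume : Measure ℝ), p x) :
    ∀ᵐ x ∂(volume : Measure ℝ), p (δ⁻¹ * x) := by
  have h0 : δ⁻¹ ≠ 0 := (inv_pos.2 hδ).ne'
  have hq : Measure.QuasiMeasurePreserving (fun x : ℝ => δ⁻¹ * x) volume volume := by
    refine ⟨measurable_const_mul _, ?_⟩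
    rw [Real.map_volume_mul_left h0]
    exact Measure.smul_absolutelyContinuous
  exact hq.ae h

/-- `f ↦ δ^{-1/2} f(x / δ)` as a linear map of `L²(ℝ)`. -/
def dilationLin (δ : Set.Ioi (0 : ℝ)) : H →ₗ[ℂ] H where
  toFun f := (((Real.sqrt δ.1)⁻¹ : ℝ) : ℂ) • (memLp_dilation δ.2 f).toLp _
  map_add' f g := by
    rw [← smul_add, ← MemLp.toLp_add]
    congr 1
    exact MemLp.toLp_congr _ _ (ae_dilation δ.2 (Lp.coeFn_add f g))
  map_smul' c f := by
    have key : (memLp_dilation δ.2 (c • f)).toLp _ = c • (memLp_dilation δ.2 f).toLp _ := by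
      rw [← MemLp.toLp_const_smul]
      exact MemLp.toLp_congr _ _ (ae_dilation δ.2 (p := fun x => (c • f : H) x = (c • ⇑f) x)
        (Lp.coeFn_smul c f))
    rw [key, RingHom.id_apply, smul_comm c]

theorem coeFn_dilationLin (δ : Set.Ioi (0 : ℝ)) (f : H) :
    dilationLin δ f =ᵐ[volume] fun x => (((Real.sqrt δ.1)⁻¹ : ℝ) : ℂ) * f (δ.1⁻¹ * x) := by
  filter_upwards [Lp.coeFn_smul (((Real.sqrt δ.1)⁻¹ : ℝ) : ℂ) ((memLp_dilation δ.2 f).toLp _),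
    (memLp_dilation δ.2 f).coeFn_toLp] with x h1 h2
  change ((((Real.sqrt δ.1)⁻¹ : ℝ) : ℂ) • (memLp_dilation δ.2 f).toLp _ : H) x = _
  rw [h1, Pi.smul_apply, h2, smul_eq_mul]

theorem dilationLin_dilationLin (δ ε : Set.Ioi (0 : ℝ)) (h : δ.1 * ε.1 = 1) (f : H) :
    dilationLin δ (dilationLin ε f) = f := by
  have hδ : (0 : ℝ) < δ.1 := δ.2
  apply Lp.ext
  filter_upwards [coeFn_dilationLin δ (dilationLin ε f),
    ae_dilation δ.2 (coeFn_dilationLin ε f)] with x h1 h2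
  rw [h1, h2, ← mul_assoc, ← mul_assoc, ← mul_inv, mul_comm ε.1, h, ← Complex.ofReal_mul,
    ← mul_inv, ← Real.sqrt_mul hδ.le, h]
  simp

theorem norm_dilationLin (δ : Set.Ioi (0 : ℝ)) (f : H) : ‖dilationLin δ f‖ = ‖f‖ := by
  have hδ : (0 : ℝ) < δ.1 := δ.2
  have h0 : δ.1⁻¹ ≠ 0 := (inv_pos.2 hδ).ne'
  have hI (g : H) : ‖g‖ ^ 2 = ∫ x, ‖g x‖ ^ 2 := by
    have := L2.inner_def (𝕜 := ℂ) g g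
    rw [inner_self_eq_norm_sq_to_K] at this
    have h2 : ((‖g‖ ^ 2 : ℝ) : ℂ) = ((∫ x, ‖g x‖ ^ 2 : ℝ) : ℂ) := by
      rw [← integral_complex_ofReal]
      simpa [inner_self_eq_norm_sq_to_K] using this
    exact_mod_cast h2
  refine (sq_eq_sq₀ (norm_nonneg _) (norm_nonneg _)).1 ?_
  rw [hI, hI, integral_congr_ae (g := fun x => δ.1⁻¹ * (fun y => ‖f y‖ ^ 2) (δ.1⁻¹ * x))]
  · rw [integral_const_mul, Measure.integral_comp_mul_left (fun y => ‖f y‖ ^ 2) δ.1⁻¹, inv_inv,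
      abs_of_pos hδ, smul_eq_mul, inv_mul_cancel_left₀ hδ.ne']
  · filter_upwards [coeFn_dilationLin δ f] with x hx
    rw [hx, norm_mul, mul_pow, Complex.norm_real, Real.norm_eq_abs, sq_abs, inv_pow,
      Real.sq_sqrt hδ.le]

/-- The unitary dilation `D(δ)`, `δ > 0`: `(D(δ) f)(x) = δ^{-1/2} f(x / δ)`, so that
`D(δ) P D(δ)⁻¹ = δ P` and `D(δ) Q D(δ)⁻¹ = δ⁻¹ Q`. -/
def dilation (δ : Set.Ioi (0 : ℝ)) : H ≃ₗᵢ[ℂ] H where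
  toLinearEquiv := LinearEquiv.ofLinearMap (dilationLin δ)
    (dilationLin ⟨δ.1⁻¹, inv_pos.2 (show (0 : ℝ) < δ.1 from δ.2)⟩)
    (LinearMap.ext fun f => dilationLin_dilationLin _ _
      (mul_inv_cancel₀ (show (0 : ℝ) < δ.1 from δ.2).ne') f)
    (LinearMap.ext fun f => dilationLin_dilationLin _ _
      (inv_mul_cancel₀ (show (0 : ℝ) < δ.1 from δ.2).ne') f)
  norm_map' := norm_dilationLin δ

/-- `lim_{δ → ∞} D(δ) A D(δ)⁻¹ = B` in the strong operator topology. -/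
def HasDilationLimit (A B : H →L[ℂ] H) : Prop :=
  ∀ φ : H, Tendsto (fun δ : Set.Ioi (0 : ℝ) => dilation δ (A ((dilation δ).symm φ))) atTop
    (𝓝 (B φ))

end

end ResolventAlgebra

open ResolventAlgebra

/-!
Conjugation by `D(δ)` turns `R(a, b, c)` into `(i c + δ a P + δ⁻¹ b Q)⁻¹`, which tends strongly to
`0` if `a ≠ 0` and to `(i c)⁻¹` if `a = 0`. Strong limits of uniformly bounded operators respect
sums, products and norm limits, so every element of the resolvent algebra has a scalar limit. The
relativistic evolution shifts `Q = i d/dp` by the derivative `t p (p² + m²)^{-1/2}` of its phase;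
the dilations turn this bounded function of `P` into `t p (p² + m² / δ²)^{-1/2}`, so that the
evolved resolvent tends to `(i c + t P / |P|)⁻¹`. This is not a scalar, because `P / |P|` is not.
-/

namespace ResolventAlgebra

section SymmetricOperators

/-! ### Resolvents of symmetric operators -/

section Closure

variable {𝕜 E F : Type*} [RCLike 𝕜] [NormedAddCommGroup E] [InnerProductSpace 𝕜 E]
  [NormedAddCommGroup F] [InnerProductSpace 𝕜 F]

theorem isFormalAdjoint_closure_right {T : E →ₗ.[𝕜] F} {S : F →ₗ.[𝕜] E}
    (h : T.IsFormalAdjoint S) : T.IsFormalAdjoint S.closure := by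
  by_cases hS : S.IsClosable
  · intro x y
    have hclosed : IsClosed {z : F × E | inner 𝕜 (T x) z.1 = inner 𝕜 (x : E) z.2} :=
      isClosed_eq (by fun_prop) (by fun_prop)
    have hgraph : ∀ z ∈ S.graph, inner 𝕜 (T x) z.1 = inner 𝕜 (x : E) z.2 := by
      intro z hz
      obtain ⟨u, hu, hSu⟩ := (LinearPMap.mem_graph_iff _).1 hz
      rw [← hu, ← hSu, h]
    have hy : ((y : F), S.closure y) ∈ S.graph.topologicalClosure := by
      rw [hS.graph_closure_eq_closure_graph]
      exact S.closure.mem_graph y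
    exact closure_minimal hgraph hclosed hy
  · rwa [LinearPMap.closure_def' hS]

theorem isFormalAdjoint_closure_self {T : E →ₗ.[𝕜] E} (hT : T.IsFormalAdjoint T) :
    T.closure.IsFormalAdjoint T.closure :=
  isFormalAdjoint_closure_right (isFormalAdjoint_closure_right hT).symm

theorem isClosable_of_isFormalAdjoint_self [CompleteSpace E] {T : E →ₗ.[𝕜] E}
    (hd : Dense (T.domain : Set E)) (hT : T.IsFormalAdjoint T) : T.IsClosable :=
  (LinearPMap.adjoint_isClosed hd).isClosable.leIsClosable (hT.le_adjoint hd)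

end Closure

variable {S S' T : H →ₗ.[ℂ] H} {R R' : H →L[ℂ] H} {c : ℝ}

/-- The linear map `i c + T` on the domain of `T`. -/
noncomputable def shifted (c : ℝ) (T : H →ₗ.[ℂ] H) : T.domain →ₗ[ℂ] H :=
  (Complex.I * (c : ℂ)) • T.domain.subtype + T.toFun

theorem shifted_apply (c : ℝ) (T : H →ₗ.[ℂ] H) (ψ : T.domain) :
    shifted c T ψ = (Complex.I * (c : ℂ)) • (ψ : H) + T ψ := rfl

theorem shiftedClosure_apply (c : ℝ) (T : H →ₗ.[ℂ] H) (ψ : T.closure.domain) :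
    shiftedClosure c T ψ = (Complex.I * (c : ℂ)) • (ψ : H) + T.closure ψ := rfl

theorem isFormalAdjoint_shiftedClosure_neg (hT : T.IsFormalAdjoint T) (c : ℝ) :
    (shiftedClosure c T).IsFormalAdjoint (shiftedClosure (-c) T) := by
  intro x y
  have h := isFormalAdjoint_closure_self hT x y
  rw [shiftedClosure_apply c T x, shiftedClosure_apply (-c) T y, inner_add_left, inner_add_right,
    inner_smul_left, inner_smul_right, h]
  simp

theorem norm_le_norm_shifted (hT : T.IsFormalAdjoint T) (c : ℝ) (ψ : T.domain) :
    |c| * ‖ψ‖ ≤ ‖shifted c T ψ‖ := by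
  have hreal : (inner ℂ (T ψ) (ψ : H)).im = 0 := by
    rw [← Complex.conj_eq_iff_im, inner_conj_symm, hT]
  have him : (inner ℂ (shifted c T ψ) (ψ : H)).im = -c * ‖ψ‖ ^ 2 := by
    rw [shifted_apply, inner_add_left, inner_smul_left, inner_self_eq_norm_sq_to_K,
      Complex.add_im, hreal]
    simp [← Complex.ofReal_pow]
  have hle : (|c| * ‖ψ‖) * ‖ψ‖ ≤ ‖shifted c T ψ‖ * ‖ψ‖ := by
    calc (|c| * ‖ψ‖) * ‖ψ‖ = |(inner ℂ (shifted c T ψ) (ψ : H)).im| := by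
          rw [him, abs_mul, abs_neg, abs_sq]; ring
      _ ≤ ‖inner ℂ (shifted c T ψ) (ψ : H)‖ := Complex.abs_im_le_norm _
      _ ≤ ‖shifted c T ψ‖ * ‖ψ‖ := norm_inner_le_norm _ _
  rcases (norm_nonneg ψ).eq_or_lt with h0 | h0
  · rw [← h0, mul_zero]; exact norm_nonneg _
  · exact le_of_mul_le_mul_right hle h0

theorem isBoundedInverse_shiftedClosure (hT : T.IsClosable) (hd : DenseRange (shifted c T))
    (hR : ∀ ψ, R (shifted c T ψ) = ψ) : IsBoundedInverse (shiftedClosure c T) R := by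
  have hgraph : ∀ z ∈ T.closure.graph, R ((Complex.I * (c : ℂ)) • z.1 + z.2) = z.1 := by
    have hclosed : IsClosed {z : H × H | R ((Complex.I * (c : ℂ)) • z.1 + z.2) = z.1} :=
      isClosed_eq (by fun_prop) (by fun_prop)
    rw [← hT.graph_closure_eq_closure_graph]
    refine fun z hz => closure_minimal (fun w hw => ?_) hclosed hz
    obtain ⟨ψ, hψ, hTψ⟩ := (LinearPMap.mem_graph_iff _).1 hw
    rw [Set.mem_ofPred_eq, ← hψ, ← hTψ]
    exact hR ψ
  have hrange : ∀ φ : H, (R φ, φ - (Complex.I * (c : ℂ)) • R φ) ∈ T.closure.graph := by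
    intro φ
    rw [← hT.graph_closure_eq_closure_graph]
    refine hd.induction_on (p := fun φ : H =>
      (R φ, φ - (Complex.I * (c : ℂ)) • R φ) ∈ T.graph.topologicalClosure) φ ?_ fun ψ => ?_
    · exact T.graph.isClosed_topologicalClosure.preimage
        (f := fun φ : H => (R φ, φ - (Complex.I * (c : ℂ)) • R φ)) (by fun_prop)
    · rw [hR, shifted_apply, add_sub_cancel_left]
      exact T.graph.le_topologicalClosure (T.mem_graph ψ)
  refine ⟨fun ψ => hgraph _ (T.closure.mem_graph ψ), fun φ => ?_⟩
  obtain ⟨ψ, hψ : (ψ : H) = R φ, hTψ⟩ := (LinearPMap.mem_graph_iff _).1 (hrange φ)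
  obtain ⟨hmem, rfl⟩ : ∃ hmem : R φ ∈ T.closure.domain, ψ = ⟨R φ, hmem⟩ :=
    ⟨hψ ▸ ψ.2, Subtype.ext hψ⟩
  refine ⟨hmem, (shiftedClosure_apply c T ⟨R φ, hmem⟩).trans ?_⟩
  rw [hTψ, add_sub_cancel]

theorem IsBoundedInverse.boundedInverse (h : IsBoundedInverse S R) :
    IsBoundedInverse S (boundedInverse S) := by
  have hex : ∃ R, IsBoundedInverse S R := ⟨R, h⟩
  rw [ResolventAlgebra.boundedInverse, dif_pos hex]
  exact hex.choose_spec

theorem isBoundedInverse_boundedInverse (hc : c ≠ 0) (hdom : Dense (T.domain : Set H))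
    (hT : T.IsFormalAdjoint T) (hd : DenseRange (shifted c T)) :
    IsBoundedInverse (shiftedClosure c T) (boundedInverse (shiftedClosure c T)) := by
  have hnorm (ψ : T.domain) : ‖T.domain.subtype ψ‖ ≤ |c|⁻¹ * ‖shifted c T ψ‖ := by
    rw [le_inv_mul_iff₀ (abs_pos.2 hc)]
    exact norm_le_norm_shifted hT c ψ
  exact (isBoundedInverse_shiftedClosure (R := T.domain.subtype.extendOfNorm (shifted c T))
    (isClosable_of_isFormalAdjoint_self hdom hT) hd
    (LinearMap.extendOfNorm_eq hd ⟨_, hnorm⟩)).boundedInverse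

theorem IsBoundedInverse.apply_shifted (h : IsBoundedInverse (shiftedClosure c T) R)
    (ψ : T.domain) : R (shifted c T ψ) = ψ := by
  rw [shifted_apply, T.le_closure.2 (y := ⟨ψ, T.le_closure.1 ψ.2⟩) rfl]
  exact h.1 ⟨ψ, T.le_closure.1 ψ.2⟩

theorem IsBoundedInverse.star_eq (hS : S.IsFormalAdjoint S') (h : IsBoundedInverse S R)
    (h' : IsBoundedInverse S' R') : star R = R' := by
  rw [ContinuousLinearMap.star_eq_adjoint, eq_comm, ContinuousLinearMap.eq_adjoint_iff]
  intro φ χ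
  obtain ⟨hφ, hSφ⟩ := h'.2 φ
  obtain ⟨hχ, hSχ⟩ := h.2 χ
  calc inner ℂ (R' φ) χ = inner ℂ (R' φ) (S ⟨R χ, hχ⟩) := by rw [hSχ]
    _ = inner ℂ (S' ⟨R' φ, hφ⟩) (R χ) := (hS.symm ⟨R' φ, hφ⟩ ⟨R χ, hχ⟩).symm
    _ = inner ℂ φ (R χ) := by rw [hSφ]

end SymmetricOperators

section SchwartzSpace

/-! ### Functions of temperate growth -/

theorem hasTemperateGrowth_sq_add_sq_rpow {m : ℝ} (hm : m ≠ 0) (r : ℝ) :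
    Function.HasTemperateGrowth fun p : ℝ => (p ^ 2 + m ^ 2) ^ r := by
  have hpos (p : ℝ) : (p ^ 2 + m ^ 2) ^ r = (m ^ 2) ^ r * (1 + ‖m⁻¹ * p‖ ^ 2) ^ r := by
    rw [← Real.mul_rpow (by positivity) (by positivity), Real.norm_eq_abs, sq_abs]
    congr 1
    field_simp
    ring
  simp only [hpos]
  exact (Function.HasTemperateGrowth.const _).mul
    ((Function.hasTemperateGrowth_one_add_norm_sq_rpow ℝ r).comp (f := fun p : ℝ => m⁻¹ * p)
      (by fun_prop))

theorem hasTemperateGrowth_sqrt_sq_add_sq {m : ℝ} (hm : m ≠ 0) :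
    Function.HasTemperateGrowth fun p : ℝ => Real.sqrt (p ^ 2 + m ^ 2) := by
  simpa only [Real.sqrt_eq_rpow] using hasTemperateGrowth_sq_add_sq_rpow hm (1 / 2)

theorem hasTemperateGrowth_div_sqrt_sq_add_sq {m : ℝ} (hm : m ≠ 0) :
    Function.HasTemperateGrowth fun p : ℝ => p / Real.sqrt (p ^ 2 + m ^ 2) := by
  have h (p : ℝ) : p / Real.sqrt (p ^ 2 + m ^ 2) = p * (p ^ 2 + m ^ 2) ^ (-(1 / 2) : ℝ) := by
    rw [Real.sqrt_eq_rpow, Real.rpow_neg (by positivity), div_eq_mul_inv]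
  simp only [h]
  exact Function.HasTemperateGrowth.id'.mul (hasTemperateGrowth_sq_add_sq_rpow hm _)

theorem I_mul_add_ne_zero {c : ℝ} (hc : c ≠ 0) (x : ℝ) : Complex.I * (c : ℂ) + (x : ℂ) ≠ 0 := by
  intro h
  simpa [hc] using congrArg Complex.im h

theorem hasTemperateGrowth_inv_I_mul_add {c : ℝ} (hc : c ≠ 0) :
    Function.HasTemperateGrowth fun x : ℝ => (Complex.I * (c : ℂ) + (x : ℂ))⁻¹ := by
  have h (x : ℝ) : (Complex.I * (c : ℂ) + (x : ℂ))⁻¹ =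
      ((x : ℂ) - Complex.I * c) * (((x ^ 2 + c ^ 2) ^ (-1 : ℝ) : ℝ) : ℂ) := by
    have hsq : (x : ℂ) ^ 2 + (c : ℂ) ^ 2 ≠ 0 := by
      exact_mod_cast (by positivity : x ^ 2 + c ^ 2 ≠ 0)
    have hmul : (Complex.I * (c : ℂ) + x) * (x - Complex.I * c) = (x : ℂ) ^ 2 + (c : ℂ) ^ 2 := by
      linear_combination (-(c : ℂ) ^ 2) * Complex.I_sq
    refine inv_eq_of_mul_eq_one_right ?_
    rw [Real.rpow_neg_one, ← mul_assoc, hmul]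
    push_cast
    exact mul_inv_cancel₀ hsq
  simp only [h]
  exact (Function.Complex.hasTemperateGrowth_ofReal.sub (.const _)).mul
    (Function.HasTemperateGrowth.comp Function.Complex.hasTemperateGrowth_ofReal
      (hasTemperateGrowth_sq_add_sq_rpow hc _))

theorem hasTemperateGrowth_cexp_mul_I :
    Function.HasTemperateGrowth fun x : ℝ => Complex.exp ((x : ℂ) * Complex.I) := by
  have hd (n : ℕ) : iteratedDeriv n (fun x : ℝ => Complex.exp ((x : ℂ) * Complex.I)) =
      fun x : ℝ => Complex.I ^ n * Complex.exp ((x : ℂ) * Complex.I) := by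
    induction n with
    | zero => simp
    | succ n ih =>
      rw [iteratedDeriv_succ, ih]
      funext x
      have h1 : HasDerivAt (fun x : ℝ => (x : ℂ) * Complex.I) (1 * Complex.I) x :=
        Complex.ofRealCLM.hasDerivAt.mul_const Complex.I
      rw [(h1.cexp.const_mul (Complex.I ^ n)).deriv]
      ring
  refine ⟨(Complex.ofRealCLM.contDiff.mul contDiff_const).cexp, fun n => ⟨0, 1, fun x => ?_⟩⟩
  rw [norm_iteratedFDeriv_eq_norm_iteratedDeriv, hd]
  simp [Complex.norm_exp_ofReal_mul_I]

theorem hasTemperateGrowth_phase {θ : ℝ → ℝ} (hθ : θ.HasTemperateGrowth) :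
    Function.HasTemperateGrowth fun x : ℝ => Complex.exp ((θ x : ℂ) * Complex.I) :=
  hasTemperateGrowth_cexp_mul_I.comp hθ

/-! ### Position and momentum on the Schwartz space -/

/-- The embedding of the Schwartz space in `L²(ℝ)`. -/
noncomputable abbrev ι : 𝓢(ℝ, ℂ) →L[ℂ] H := toLpCLM ℂ ℂ 2 (volume : Measure ℝ)

theorem denseRange_ι : DenseRange ι :=
  denseRange_toLpCLM (F := ℂ) (E := ℝ) (μ := volume) ENNReal.ofNat_ne_top

/-- The function `g(Q)` of the position operator on the Schwartz space: multiplication by `g`.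
It is `0` when `g` is not of temperate growth. -/
noncomputable abbrev schwartzFunQ (g : ℝ → ℂ) : 𝓢(ℝ, ℂ) →L[ℂ] 𝓢(ℝ, ℂ) := smulLeftCLM ℂ g

/-- The function `g(P)` of the momentum operator on the Schwartz space. As in `funP`, momentum
`p` is `2πξ` in terms of the variable `ξ` of the Fourier transform. -/
noncomputable def schwartzFunP (g : ℝ → ℂ) : 𝓢(ℝ, ℂ) →L[ℂ] 𝓢(ℝ, ℂ) :=
  fourierMultiplierCLM ℂ fun ξ : ℝ => g (2 * Real.pi * ξ)

/-- The position operator on the Schwartz space. -/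
noncomputable abbrev schwartzQ : 𝓢(ℝ, ℂ) →L[ℂ] 𝓢(ℝ, ℂ) := smulLeftCLM ℂ (fun x : ℝ => (x : ℂ))

/-- The momentum operator on the Schwartz space. -/
noncomputable abbrev schwartzP : 𝓢(ℝ, ℂ) →L[ℂ] 𝓢(ℝ, ℂ) := -Complex.I • derivCLM ℂ ℂ

variable {g g' : ℝ → ℂ}

theorem hasTemperateGrowth_scaled (hg : g.HasTemperateGrowth) (k : ℝ) :
    Function.HasTemperateGrowth fun ξ : ℝ => g (k * ξ) :=
  hg.comp (f := fun ξ : ℝ => k * ξ) (by fun_prop)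

theorem derivCLM_eq_lineDerivOp (f : 𝓢(ℝ, ℂ)) :
    derivCLM ℂ ℂ f = LineDeriv.lineDerivOp (1 : ℝ) f := by
  ext x
  rw [derivCLM_apply, lineDerivOp_apply_eq_fderiv, fderiv_apply_one_eq_deriv]

theorem smulLeftCLM_inner_one (f : 𝓢(ℝ, ℂ)) :
    smulLeftCLM ℂ (inner ℝ · (1 : ℝ)) f = schwartzQ f := by
  ext x
  rw [smulLeftCLM_apply_apply (Function.hasTemperateGrowth_inner_left 1),
    smulLeftCLM_apply_apply Function.Complex.hasTemperateGrowth_ofReal]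
  simp

theorem fourier_schwartzP (f : 𝓢(ℝ, ℂ)) :
    𝓕 (schwartzP f) = (2 * Real.pi : ℂ) • schwartzQ (𝓕 f) := by
  change 𝓕 (-Complex.I • derivCLM ℂ ℂ f) = _
  rw [derivCLM_eq_lineDerivOp, FourierTransform.fourier_smul, fourier_lineDerivOp_eq,
    smulLeftCLM_inner_one, smul_smul]
  congr 1
  linear_combination (-2 * Real.pi : ℂ) * Complex.I_sq

theorem schwartzP_fourier (f : 𝓢(ℝ, ℂ)) :
    schwartzP (𝓕 f) = (-(2 * Real.pi) : ℂ) • 𝓕 (schwartzQ f) := by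
  change -Complex.I • derivCLM ℂ ℂ (𝓕 f) = _
  rw [derivCLM_eq_lineDerivOp, lineDerivOp_fourier_eq, smulLeftCLM_inner_one,
    FourierTransform.fourier_smul, smul_smul]
  congr 1
  linear_combination (2 * Real.pi : ℂ) * Complex.I_sq

theorem fourier_schwartzFunP (g : ℝ → ℂ) (f : 𝓢(ℝ, ℂ)) :
    𝓕 (schwartzFunP g f) = schwartzFunQ (fun ξ => g (2 * Real.pi * ξ)) (𝓕 f) := by
  rw [schwartzFunP, fourierMultiplierCLM_apply, FourierTransform.fourier_fourierInv_eq]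

theorem fourier_injective : Function.Injective (𝓕 : 𝓢(ℝ, ℂ) → 𝓢(ℝ, ℂ)) :=
  Function.LeftInverse.injective FourierTransform.fourierInv_fourier_eq

theorem schwartzFunP_ofReal (f : 𝓢(ℝ, ℂ)) : schwartzFunP (fun p => (p : ℂ)) f = schwartzP f := by
  apply fourier_injective
  rw [fourier_schwartzFunP, fourier_schwartzP]
  have h : (fun ξ : ℝ => ((2 * Real.pi * ξ : ℝ) : ℂ)) =
      (2 * Real.pi : ℂ) • fun ξ : ℝ => (ξ : ℂ) := by
    ext ξ
    simp
  rw [h, schwartzFunQ, smulLeftCLM_smul Function.Complex.hasTemperateGrowth_ofReal]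
  rfl

theorem schwartzFunP_const (z : ℂ) (f : 𝓢(ℝ, ℂ)) : schwartzFunP (fun _ => z) f = z • f := by
  rw [schwartzFunP, fourierMultiplierCLM_const]
  rfl

theorem schwartzFunP_schwartzFunP {h : ℝ → ℂ} (hg : g.HasTemperateGrowth)
    (hh : h.HasTemperateGrowth) (f : 𝓢(ℝ, ℂ)) :
    schwartzFunP g (schwartzFunP h f) = schwartzFunP (fun p => g p * h p) f :=
  fourierMultiplierCLM_fourierMultiplierCLM_apply (hasTemperateGrowth_scaled hg _)
    (hasTemperateGrowth_scaled hh _) f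

theorem schwartzP_schwartzFunQ (hg : g.HasTemperateGrowth) (hg' : g'.HasTemperateGrowth)
    (hd : ∀ x, HasDerivAt g (g' x) x) (f : 𝓢(ℝ, ℂ)) :
    schwartzP (schwartzFunQ g f) = schwartzFunQ g (schwartzP f) -
      Complex.I • schwartzFunQ g' f := by
  ext x
  have hfun : ⇑(schwartzFunQ g f) = g * ⇑f := by
    ext y
    rw [smulLeftCLM_apply_apply hg, smul_eq_mul, Pi.mul_apply]
  change -Complex.I * deriv (schwartzFunQ g f) x =
    schwartzFunQ g (schwartzP f) x - Complex.I * schwartzFunQ g' f x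
  rw [hfun, ((hd x).mul (f.hasDerivAt x)).deriv, smulLeftCLM_apply_apply hg,
    smulLeftCLM_apply_apply hg']
  change _ = g x * (-Complex.I * deriv f x) - Complex.I * (g' x * f x)
  ring

theorem schwartzQ_schwartzFunP (hg : g.HasTemperateGrowth) (hg' : g'.HasTemperateGrowth)
    (hd : ∀ p, HasDerivAt g (g' p) p) (f : 𝓢(ℝ, ℂ)) :
    schwartzQ (schwartzFunP g f) = schwartzFunP g (schwartzQ f) +
      Complex.I • schwartzFunP g' f := by
  have h2π : (-(2 * Real.pi) : ℂ) ≠ 0 := by simp [Real.pi_ne_zero]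
  have hsg' := hasTemperateGrowth_scaled hg' (2 * Real.pi)
  have hsmul : Function.HasTemperateGrowth ((2 * Real.pi : ℂ) • fun ξ => g' (2 * Real.pi * ξ)) :=
    (Function.HasTemperateGrowth.const _).mul hsg'
  have hscaled (ξ : ℝ) : HasDerivAt (fun ξ => g (2 * Real.pi * ξ))
      (((2 * Real.pi : ℂ) • fun ξ => g' (2 * Real.pi * ξ)) ξ) ξ := by
    simpa [Function.comp_def] using
      (hd (2 * Real.pi * ξ)).scomp ξ ((hasDerivAt_id ξ).const_mul (2 * Real.pi))
  apply fourier_injective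
  apply smul_right_injective _ h2π
  dsimp only
  rw [← schwartzP_fourier, fourier_schwartzFunP, schwartzP_schwartzFunQ
    (hasTemperateGrowth_scaled hg _) hsmul hscaled,
    schwartzP_fourier, FourierTransform.fourier_add, FourierTransform.fourier_smul,
    fourier_schwartzFunP, fourier_schwartzFunP, map_smul, schwartzFunQ, schwartzFunQ,
    smulLeftCLM_smul hsg', smul_apply]
  module

theorem inner_ι_schwartzFunQ {g : ℝ → ℝ} (hg : g.HasTemperateGrowth) (f h : 𝓢(ℝ, ℂ)) :
    inner ℂ (ι (schwartzFunQ (fun x => (g x : ℂ)) f)) (ι h) =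
      inner ℂ (ι f) (ι (schwartzFunQ (fun x => (g x : ℂ)) h)) := by
  have hgC : Function.HasTemperateGrowth fun x => (g x : ℂ) :=
    Function.Complex.hasTemperateGrowth_ofReal.comp hg
  refine (inner_toL2_toL2_eq _ _ volume).trans (.trans ?_ (inner_toL2_toL2_eq _ _ volume).symm)
  congr 1
  funext x
  rw [smulLeftCLM_apply_apply hgC, smulLeftCLM_apply_apply hgC, inner_smul_left,
    inner_smul_right, Complex.conj_ofReal]

theorem inner_ι_schwartzQ (f h : 𝓢(ℝ, ℂ)) :
    inner ℂ (ι (schwartzQ f)) (ι h) = inner ℂ (ι f) (ι (schwartzQ h)) :=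
  inner_ι_schwartzFunQ Function.HasTemperateGrowth.id' f h

theorem inner_ι_fourier (f h : 𝓢(ℝ, ℂ)) :
    inner ℂ (ι (𝓕 f)) (ι (𝓕 h)) = inner ℂ (ι f) (ι h) := by
  change inner ℂ ((𝓕 f).toLp 2) ((𝓕 h).toLp 2) = inner ℂ (f.toLp 2) (h.toLp 2)
  rw [← toLp_fourier_eq, ← toLp_fourier_eq, Lp.inner_fourier_eq]

theorem inner_ι_schwartzP (f h : 𝓢(ℝ, ℂ)) :
    inner ℂ (ι (schwartzP f)) (ι h) = inner ℂ (ι f) (ι (schwartzP h)) := by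
  rw [← inner_ι_fourier, ← inner_ι_fourier f, fourier_schwartzP, fourier_schwartzP, map_smul,
    map_smul, inner_smul_left, inner_smul_right, inner_ι_schwartzQ, map_mul, Complex.conj_ofReal,
    map_ofNat]

end SchwartzSpace

section BasicResolvents

/-! ### Operators with Schwartz domain -/

section OnSchwartz

variable {A : 𝓢(ℝ, ℂ) →L[ℂ] 𝓢(ℝ, ℂ)} {c : ℝ}

theorem dense_schwartzDomain : Dense (schwartzDomain : Set H) := denseRange_ι

theorem exists_ι_eq (ψ : schwartzDomain) : ∃ f, ψ = ⟨ι f, f, rfl⟩ := by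
  obtain ⟨_, f, rfl⟩ := ψ
  exact ⟨f, rfl⟩

theorem onSchwartz_apply (A : 𝓢(ℝ, ℂ) →L[ℂ] 𝓢(ℝ, ℂ)) (f : 𝓢(ℝ, ℂ))
    (hf : ι f ∈ (onSchwartz A).domain) : onSchwartz A ⟨ι f, hf⟩ = ι (A f) := by
  change ι (A (schwartzEquiv.symm ⟨ι f, hf⟩)) = ι (A f)
  congr 2
  rw [LinearEquiv.symm_apply_eq]
  rfl

theorem eq_onSchwartz {T : H →ₗ.[ℂ] H} (hdom : T.domain = schwartzDomain)
    (hT : ∀ f (hf : ι f ∈ T.domain), T ⟨ι f, hf⟩ = ι (A f)) : T = onSchwartz A := by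
  refine LinearPMap.ext hdom fun ψ hψ hψ' => ?_
  obtain ⟨f, rfl⟩ := id hψ'
  exact (hT f hψ).trans (onSchwartz_apply A f hψ').symm

theorem isFormalAdjoint_onSchwartz (hA : ∀ f g, inner ℂ (ι (A f)) (ι g) = inner ℂ (ι f) (ι (A g))) :
    (onSchwartz A).IsFormalAdjoint (onSchwartz A) := by
  intro φ ψ
  obtain ⟨f, rfl⟩ := exists_ι_eq φ
  obtain ⟨g, rfl⟩ := exists_ι_eq ψ
  exact (congrArg (inner ℂ · (ι g)) (onSchwartz_apply A f _)).trans
    ((hA f g).trans (congrArg (inner ℂ (ι f)) (onSchwartz_apply A g _).symm))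

theorem shifted_onSchwartz (f : 𝓢(ℝ, ℂ)) (hf : ι f ∈ (onSchwartz A).domain) :
    shifted c (onSchwartz A) ⟨ι f, hf⟩ = ι ((Complex.I * (c : ℂ)) • f + A f) := by
  rw [shifted_apply, onSchwartz_apply, map_add, map_smul]

theorem denseRange_shifted_onSchwartz
    (hs : Function.Surjective fun f => (Complex.I * (c : ℂ)) • f + A f) :
    DenseRange (shifted c (onSchwartz A)) := by
  have h : DenseRange fun f => ι ((Complex.I * (c : ℂ)) • f + A f) :=
    denseRange_ι.comp hs.denseRange ι.continuous
  refine h.mono ?_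
  rintro _ ⟨f, rfl⟩
  exact ⟨⟨ι f, f, rfl⟩, shifted_onSchwartz f _⟩

theorem isBoundedInverse_onSchwartz (hc : c ≠ 0)
    (hA : ∀ f g, inner ℂ (ι (A f)) (ι g) = inner ℂ (ι f) (ι (A g)))
    (hs : Function.Surjective fun f => (Complex.I * (c : ℂ)) • f + A f) :
    IsBoundedInverse (shiftedClosure c (onSchwartz A))
      (boundedInverse (shiftedClosure c (onSchwartz A))) :=
  isBoundedInverse_boundedInverse hc dense_schwartzDomain (isFormalAdjoint_onSchwartz hA)
    (denseRange_shifted_onSchwartz hs)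

theorem IsBoundedInverse.apply_onSchwartz {R : H →L[ℂ] H}
    (h : IsBoundedInverse (shiftedClosure c (onSchwartz A)) R) (f : 𝓢(ℝ, ℂ)) :
    R (ι ((Complex.I * (c : ℂ)) • f + A f)) = ι f := by
  rw [← shifted_onSchwartz f ⟨f, rfl⟩]
  exact h.apply_shifted _

end OnSchwartz

/-! ### The basic resolvents -/

/-- The operator `a P + b Q` on the Schwartz space. -/
noncomputable def schwartzLinComb (a b : ℝ) : 𝓢(ℝ, ℂ) →L[ℂ] 𝓢(ℝ, ℂ) :=
  (a : ℂ) • schwartzP + (b : ℂ) • schwartzQ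

theorem schwartzLinComb_apply (a b : ℝ) (f : 𝓢(ℝ, ℂ)) :
    schwartzLinComb a b f = (a : ℂ) • schwartzP f + (b : ℂ) • schwartzQ f := rfl

theorem linComb_eq_onSchwartz (a b : ℝ) : linComb a b = onSchwartz (schwartzLinComb a b) :=
  eq_onSchwartz (inf_idem _) fun f hf =>
    congrArg₂ (fun φ ψ : H => (a : ℂ) • φ + (b : ℂ) • ψ) (onSchwartz_apply _ f hf.1)
      (onSchwartz_apply _ f hf.2)

theorem inner_ι_schwartzLinComb (a b : ℝ) (f g : 𝓢(ℝ, ℂ)) :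
    inner ℂ (ι (schwartzLinComb a b f)) (ι g) = inner ℂ (ι f) (ι (schwartzLinComb a b g)) := by
  simp only [schwartzLinComb_apply, map_add, map_smul, inner_add_left, inner_add_right,
    inner_smul_left, inner_smul_right, Complex.conj_ofReal, inner_ι_schwartzP, inner_ι_schwartzQ]

variable {c : ℝ}

theorem surjective_I_smul_add_smul_schwartzQ (hc : c ≠ 0) (b : ℝ) :
    Function.Surjective fun f : 𝓢(ℝ, ℂ) => (Complex.I * (c : ℂ)) • f + (b : ℂ) • schwartzQ f := by
  intro h
  have hinv : Function.HasTemperateGrowth fun x : ℝ => (Complex.I * (c : ℂ) + (b * x : ℝ))⁻¹ :=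
    hasTemperateGrowth_scaled (hasTemperateGrowth_inv_I_mul_add hc) b
  refine ⟨schwartzFunQ (fun x : ℝ => (Complex.I * (c : ℂ) + (b * x : ℝ))⁻¹) h, ?_⟩
  ext x
  have hx := I_mul_add_ne_zero hc (b * x)
  simp only [add_apply, smul_apply, smul_eq_mul,
    smulLeftCLM_apply_apply Function.Complex.hasTemperateGrowth_ofReal,
    smulLeftCLM_apply_apply hinv]
  rw [← mul_assoc (b : ℂ), ← add_mul, ← Complex.ofReal_mul, mul_inv_cancel_left₀ hx]

theorem surjective_I_smul_add_smul_schwartzP (hc : c ≠ 0) (a : ℝ) :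
    Function.Surjective fun f : 𝓢(ℝ, ℂ) => (Complex.I * (c : ℂ)) • f + (a : ℂ) • schwartzP f := by
  intro h
  obtain ⟨u, hu⟩ := surjective_I_smul_add_smul_schwartzQ hc (2 * Real.pi * a) (𝓕 h)
  refine ⟨𝓕⁻ u, fourier_injective ?_⟩
  dsimp only at hu ⊢
  rw [FourierTransform.fourier_add, FourierTransform.fourier_smul, FourierTransform.fourier_smul,
    fourier_schwartzP, FourierTransform.fourier_fourierInv_eq, ← hu, smul_smul]
  congr 2
  push_cast
  ring

/-- The Gaussian phase `e^{-i b x² / (2 a)}`, which gauges `a P + b Q` to `a P`. -/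
noncomputable def gauge (a b x : ℝ) : ℂ := Complex.exp ((-(b / (2 * a)) * x ^ 2 : ℝ) * Complex.I)

theorem hasTemperateGrowth_gauge (a b : ℝ) : (gauge a b).HasTemperateGrowth :=
  hasTemperateGrowth_phase ((Function.HasTemperateGrowth.const _).mul
    (Function.HasTemperateGrowth.id'.pow 2))

theorem hasDerivAt_gauge (a b x : ℝ) :
    HasDerivAt (gauge a b) (-Complex.I * (b / a) * (x * gauge a b x)) x := by
  have h : HasDerivAt (fun x : ℝ => -(b / (2 * a)) * x ^ 2) (-(b / (2 * a)) * (2 * x)) x := by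
    simpa using (hasDerivAt_pow 2 x).const_mul (-(b / (2 * a)))
  refine HasDerivAt.congr_deriv (f := gauge a b) (h.ofReal_comp.mul_const Complex.I).cexp ?_
  rw [gauge]
  push_cast
  ring

theorem schwartzFunQ_gauge_neg (a b : ℝ) (f : 𝓢(ℝ, ℂ)) :
    schwartzFunQ (gauge a b) (schwartzFunQ (gauge a (-b)) f) = f := by
  ext x
  rw [smulLeftCLM_apply_apply (hasTemperateGrowth_gauge a b),
    smulLeftCLM_apply_apply (hasTemperateGrowth_gauge a (-b)), smul_smul, gauge, gauge,
    ← Complex.exp_add, ← add_mul, ← Complex.ofReal_add]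
  simp [neg_div]

theorem schwartzLinComb_gauge {a : ℝ} (ha : a ≠ 0) (b : ℝ) (f : 𝓢(ℝ, ℂ)) :
    schwartzLinComb a b (schwartzFunQ (gauge a b) f) =
      schwartzFunQ (gauge a b) ((a : ℂ) • schwartzP f) := by
  have haC : (a : ℂ) ≠ 0 := by exact_mod_cast ha
  have hg := hasTemperateGrowth_gauge a b
  have hxg : Function.HasTemperateGrowth ((fun x : ℝ => (x : ℂ)) * gauge a b) :=
    Function.Complex.hasTemperateGrowth_ofReal.mul hg
  have hP := schwartzP_schwartzFunQ hg ((Function.HasTemperateGrowth.const _).mul hxg)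
    (g' := (-Complex.I * (b / a) : ℂ) • ((fun x : ℝ => (x : ℂ)) * gauge a b))
    (hasDerivAt_gauge a b) f
  have hI : (a : ℂ) * Complex.I * (-Complex.I * (b / a)) = b := by
    field_simp
    rw [Complex.I_sq]
    ring
  rw [schwartzLinComb_apply, hP, schwartzFunQ, schwartzFunQ, smulLeftCLM_smul hxg,
    smulLeftCLM_smulLeftCLM_apply Function.Complex.hasTemperateGrowth_ofReal hg]
  generalize schwartzP f = Pf
  rw [map_smul, smul_apply, smul_sub, smul_smul, smul_smul, hI]
  exact sub_add_cancel _ _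

theorem surjective_I_smul_add_schwartzLinComb (hc : c ≠ 0) (a b : ℝ) :
    Function.Surjective fun f => (Complex.I * (c : ℂ)) • f + schwartzLinComb a b f := by
  obtain rfl | ha := eq_or_ne a 0
  · simpa [schwartzLinComb_apply] using surjective_I_smul_add_smul_schwartzQ hc b
  intro h
  obtain ⟨g, hg⟩ := surjective_I_smul_add_smul_schwartzP hc a (schwartzFunQ (gauge a (-b)) h)
  refine ⟨schwartzFunQ (gauge a b) g, ?_⟩
  dsimp only at hg ⊢
  rw [schwartzLinComb_gauge ha, ← map_smul, ← map_add, hg, schwartzFunQ_gauge_neg]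

theorem isBoundedInverse_basicResolvent (hc : c ≠ 0) (a b : ℝ) :
    IsBoundedInverse (shiftedClosure c (linComb a b)) (basicResolvent a b c) := by
  rw [basicResolvent, linComb_eq_onSchwartz]
  exact isBoundedInverse_onSchwartz hc (inner_ι_schwartzLinComb a b)
    (surjective_I_smul_add_schwartzLinComb hc a b)

theorem basicResolvent_apply (hc : c ≠ 0) (a b : ℝ) (f : 𝓢(ℝ, ℂ)) :
    basicResolvent a b c (ι ((Complex.I * (c : ℂ)) • f + schwartzLinComb a b f)) = ι f := by
  have h := isBoundedInverse_basicResolvent hc a b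
  rw [linComb_eq_onSchwartz] at h
  exact h.apply_onSchwartz f

theorem star_basicResolvent (hc : c ≠ 0) (a b : ℝ) :
    star (basicResolvent a b c) = basicResolvent a b (-c) := by
  have hsymm : (linComb a b).IsFormalAdjoint (linComb a b) := by
    rw [linComb_eq_onSchwartz]
    exact isFormalAdjoint_onSchwartz (inner_ι_schwartzLinComb a b)
  exact (isBoundedInverse_basicResolvent hc a b).star_eq
    (isFormalAdjoint_shiftedClosure_neg hsymm c)
    (isBoundedInverse_basicResolvent (neg_ne_zero.2 hc) a b)

theorem basicResolvent_mem (hc : c ≠ 0) (a b : ℝ) : basicResolvent a b c ∈ resolventAlgebra :=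
  StarSubalgebra.le_topologicalClosure _ (StarAlgebra.subset_adjoin _ _ ⟨a, b, c, hc, rfl⟩)

end BasicResolvents

section Momentum

/-! ### Bounded functions of the momentum operator -/

theorem norm_sq_eq_integral (φ : H) : ‖φ‖ ^ 2 = ∫ x, ‖φ x‖ ^ 2 := by
  have h : ((‖φ‖ ^ 2 : ℝ) : ℂ) = ((∫ x, ‖φ x‖ ^ 2 : ℝ) : ℂ) := by
    rw [← integral_complex_ofReal, Complex.ofReal_pow]
    simpa [inner_self_eq_norm_sq_to_K] using L2.inner_def (𝕜 := ℂ) φ φ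
  exact_mod_cast h

theorem exists_ae_ne_zero : ∃ φ : H, ∀ᵐ x, φ x ≠ 0 := by
  have hL2 : MemLp (fun x : ℝ => (Real.exp (-1 * x ^ 2) : ℂ)) 2 volume := by
    rw [memLp_two_iff_integrable_sq_norm (by fun_prop)]
    convert! integrable_exp_neg_mul_sq (b := 2) two_pos using 2 with x
    rw [Complex.norm_real, Real.norm_eq_abs, Real.abs_exp, ← Real.exp_nat_mul]
    push_cast
    ring_nf
  refine ⟨hL2.toLp _, ?_⟩
  filter_upwards [hL2.coeFn_toLp] with x hx
  rw [hx]
  exact_mod_cast (Real.exp_pos _).ne'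

instance : Nontrivial H := by
  obtain ⟨φ, hφ⟩ := exists_ae_ne_zero
  refine nontrivial_of_ne φ 0 ?_
  rintro rfl
  obtain ⟨x, hx, hx0⟩ := (hφ.and (Lp.coeFn_zero ℂ 2 volume)).exists
  exact hx hx0

theorem eq_of_fourier_ae_eq {φ ψ : H} (h : (𝓕 φ : H) =ᵐ[volume] (𝓕 ψ : H)) : φ = ψ :=
  (Lp.fourierTransformₗᵢ ℝ ℂ).injective (Lp.ext h)

theorem fourier_ι (f : 𝓢(ℝ, ℂ)) : 𝓕 (ι f) = ι (𝓕 f) := SchwartzMap.toLp_fourier_eq f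

theorem coeFn_ι (f : 𝓢(ℝ, ℂ)) : ι f =ᵐ[volume] f := f.coeFn_toLp 2 volume

theorem ae_momentum_iff {p : ℝ → Prop} : (∀ᵐ ξ : ℝ, p (2 * Real.pi * ξ)) ↔ ∀ᵐ x, p x := by
  refine ⟨fun h => ?_, fun h => ?_⟩
  · filter_upwards [ae_dilation Real.two_pi_pos h] with x hx
    rwa [mul_inv_cancel_left₀ Real.two_pi_pos.ne'] at hx
  · simpa only [inv_inv] using ae_dilation (inv_pos.2 Real.two_pi_pos) h

theorem coeFn_mulOp (g : ℝ → ℂ) (hg : MemLp g ⊤ volume) (φ : H) :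
    mulOp g hg φ =ᵐ[volume] fun x => g x * φ x := by
  filter_upwards [(ContinuousLinearMap.mul ℂ ℂ).coeFn_holder (r := 2) (hg.toLp g) φ,
    hg.coeFn_toLp] with x h hx
  rw [← hx]
  exact h

variable {g h k : ℝ → ℂ} {C K M : ℝ}

theorem fourier_funP (hg : Measurable g) (hC : ∀ p, ‖g p‖ ≤ C) (φ : H) :
    𝓕 (funP g hg hC φ) = mulOp (fun ξ => g (2 * Real.pi * ξ)) (memLp_scaled hg hC) (𝓕 φ) :=
  (Lp.fourierTransformₗᵢ ℝ ℂ).apply_symm_apply _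

theorem coeFn_fourier_funP (hg : Measurable g) (hC : ∀ p, ‖g p‖ ≤ C) (φ : H) :
    (𝓕 (funP g hg hC φ) : H) =ᵐ[volume] fun ξ => g (2 * Real.pi * ξ) * (𝓕 φ : H) ξ := by
  rw [fourier_funP]
  exact coeFn_mulOp _ _ _

theorem funP_ι (hg : Measurable g) (hC : ∀ p, ‖g p‖ ≤ C) (hgt : g.HasTemperateGrowth)
    (f : 𝓢(ℝ, ℂ)) : funP g hg hC (ι f) = ι (schwartzFunP g f) := by
  apply eq_of_fourier_ae_eq
  rw [fourier_ι, fourier_schwartzFunP]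
  filter_upwards [coeFn_fourier_funP hg hC (ι f), coeFn_ι (𝓕 f),
    coeFn_ι (schwartzFunQ (fun ξ => g (2 * Real.pi * ξ)) (𝓕 f))] with ξ h1 h2 h3
  rw [h1, h3, fourier_ι, h2, smulLeftCLM_apply_apply (hasTemperateGrowth_scaled hgt _),
    smul_eq_mul]

theorem funP_mul_funP (hg : Measurable g) (hC : ∀ p, ‖g p‖ ≤ C) (hh : Measurable h)
    (hK : ∀ p, ‖h p‖ ≤ K) (hk : Measurable k) (hM : ∀ p, ‖k p‖ ≤ M) (hgh : ∀ p, g p * h p = k p) :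
    funP g hg hC * funP h hh hK = funP k hk hM := by
  ext1 φ
  apply eq_of_fourier_ae_eq
  filter_upwards [coeFn_fourier_funP hg hC (funP h hh hK φ), coeFn_fourier_funP hh hK φ,
    coeFn_fourier_funP hk hM φ] with ξ h1 h2 h3
  rw [mul_apply_eq_comp, h1, h2, h3, ← hgh]
  exact (mul_assoc _ _ _).symm

theorem funP_eq_smul_one_iff (hg : Measurable g) (hC : ∀ p, ‖g p‖ ≤ C) {z : ℂ} :
    funP g hg hC = z • (1 : H →L[ℂ] H) ↔ ∀ᵐ p, g p = z := by
  rw [← ae_momentum_iff]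
  have hz (φ : H) : (𝓕 ((z • (1 : H →L[ℂ] H)) φ) : H) = z • (𝓕 φ : H) :=
    (Lp.fourierTransformₗᵢ ℝ ℂ).map_smul z φ
  refine ⟨fun h => ?_, fun h => ContinuousLinearMap.ext fun φ => eq_of_fourier_ae_eq ?_⟩
  · obtain ⟨ψ, hψ⟩ := exists_ae_ne_zero
    obtain ⟨φ, rfl⟩ : ∃ φ : H, 𝓕 φ = ψ := (Lp.fourierTransformₗᵢ ℝ ℂ).surjective ψ
    have hφ := coeFn_fourier_funP hg hC φ
    rw [h, hz] at hφ
    filter_upwards [hφ, hψ, Lp.coeFn_smul z (𝓕 φ : H)] with ξ h1 h2 h3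
    rw [h3, Pi.smul_apply, smul_eq_mul] at h1
    exact (mul_right_cancel₀ h2 h1).symm
  · rw [hz]
    filter_upwards [h, coeFn_fourier_funP hg hC φ, Lp.coeFn_smul z (𝓕 φ : H)] with ξ h1 h2 h3
    rw [h2, h1, h3, Pi.smul_apply, smul_eq_mul]

theorem isSelfAdjoint_funP {g : ℝ → ℝ} (hg : Measurable fun p => (g p : ℂ))
    (hC : ∀ p, ‖(g p : ℂ)‖ ≤ C) : IsSelfAdjoint (funP (fun p => (g p : ℂ)) hg hC) := by
  rw [ContinuousLinearMap.isSelfAdjoint_iff_isSymmetric]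
  intro φ ψ
  rw [ContinuousLinearMap.coe_coe, ← Lp.inner_fourier_eq, ← Lp.inner_fourier_eq φ, L2.inner_def,
    L2.inner_def]
  refine integral_congr_ae ?_
  filter_upwards [coeFn_fourier_funP hg hC φ, coeFn_fourier_funP hg hC ψ] with ξ h1 h2
  rw [h1, h2, RCLike.inner_apply, RCLike.inner_apply, map_mul, Complex.conj_ofReal]
  ring

section Limits

variable {α : Type*} {l : Filter α} [l.IsCountablyGenerated] {u : α → ℝ → ℂ}

theorem tendsto_integral_norm_sub_mul_sq (hu : ∀ i, Measurable (u i)) (hC : ∀ i p, ‖u i p‖ ≤ C)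
    (hg : Measurable g) (hK : ∀ p, ‖g p‖ ≤ K)
    (hlim : ∀ᵐ p, Tendsto (u · p) l (𝓝 (g p))) (φ : H) :
    Tendsto (fun i => ∫ p, ‖(u i p - g p) * φ p‖ ^ 2) l (𝓝 0) := by
  have hφ : AEStronglyMeasurable φ volume := Lp.aestronglyMeasurable φ
  rw [← integral_zero ℝ ℝ (μ := volume)]
  refine tendsto_integral_filter_of_dominated_convergence (fun p => (C + K) ^ 2 * ‖φ p‖ ^ 2)
    (Eventually.of_forall fun i =>
      ((((hu i).sub hg).aestronglyMeasurable.mul hφ).norm.pow 2))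
    (Eventually.of_forall fun i => Eventually.of_forall fun p => ?_)
    (((memLp_two_iff_integrable_sq_norm hφ).1 (Lp.memLp φ)).const_mul _) ?_
  · rw [Real.norm_of_nonneg (by positivity), norm_mul, mul_pow]
    gcongr
    exact (norm_sub_le _ _).trans (add_le_add (hC i p) (hK p))
  · filter_upwards [hlim] with p hp
    simpa using ((hp.sub_const (g p)).mul_const (φ p)).norm.pow 2

theorem tendsto_funP (hu : ∀ i, Measurable (u i)) (hC : ∀ i p, ‖u i p‖ ≤ C) (hg : Measurable g)
    (hK : ∀ p, ‖g p‖ ≤ K) (hlim : ∀ᵐ p, Tendsto (u · p) l (𝓝 (g p))) (φ : H) :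
    Tendsto (fun i => funP (u i) (hu i) (hC i) φ) l (𝓝 (funP g hg hK φ)) := by
  have hnorm (i : α) : ‖funP (u i) (hu i) (hC i) φ - funP g hg hK φ‖ ^ 2 =
      ∫ ξ, ‖(u i (2 * Real.pi * ξ) - g (2 * Real.pi * ξ)) * (𝓕 φ : H) ξ‖ ^ 2 := by
    have hsub (χ ψ : H) : (𝓕 (χ - ψ) : H) = 𝓕 χ - 𝓕 ψ := (Lp.fourierTransformₗᵢ ℝ ℂ).map_sub χ ψ
    rw [← Lp.norm_fourier_eq, hsub, norm_sq_eq_integral]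
    refine integral_congr_ae ?_
    filter_upwards [coeFn_fourier_funP (hu i) (hC i) φ, coeFn_fourier_funP hg hK φ,
      Lp.coeFn_sub (𝓕 (funP (u i) (hu i) (hC i) φ) : H) (𝓕 (funP g hg hK φ))] with ξ h1 h2 h3
    rw [h3, Pi.sub_apply, h1, h2, sub_mul]
  have hsq := tendsto_integral_norm_sub_mul_sq (l := l)
    (fun i => (hu i).comp (measurable_const_mul (2 * Real.pi))) (fun i p => hC i _)
    (hg.comp (measurable_const_mul (2 * Real.pi))) (fun p => hK _) (ae_momentum_iff.2 hlim) (𝓕 φ)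
  rw [tendsto_iff_norm_sub_tendsto_zero]
  refine ((Real.continuous_sqrt.tendsto' 0 0 Real.sqrt_zero).comp hsq).congr fun i => ?_
  rw [Function.comp_apply, ← Real.sqrt_sq (norm_nonneg (_ - _)), hnorm]
  rfl

end Limits

/-! ### The operator `i c + t P / |P|` -/

theorem isUnit_I_smul_one_add {A : Type*} [CStarAlgebra A] {a : A} (ha : IsSelfAdjoint a) {c : ℝ}
    (hc : c ≠ 0) : IsUnit ((Complex.I * (c : ℂ)) • (1 : A) + a) := by
  by_contra h
  have hmem : -(Complex.I * (c : ℂ)) ∈ spectrum ℂ a := by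
    rw [spectrum.mem_iff, ← IsUnit.neg_iff, neg_sub, Algebra.algebraMap_eq_smul_one, neg_smul,
      sub_neg_eq_add, add_comm]
    exact h
  simpa [hc] using ha.im_eq_zero_of_mem_spectrum hmem

theorem isUnit_limitOp (t : ℝ) {c : ℝ} (hc : c ≠ 0) : IsUnit (limitOp t c) :=
  isUnit_I_smul_one_add (.smul (Complex.conj_ofReal t) (isSelfAdjoint_funP _ _)) hc

theorem signP_ne_smul_one (z : ℂ) : signP ≠ z • (1 : H →L[ℂ] H) := by
  intro h
  have hd := Measure.dense_of_ae ((funP_eq_smul_one_iff _ _).1 h)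
  obtain ⟨p, hp, hzp⟩ := hd.exists_mem_open isOpen_Ioi ⟨1, Set.mem_Ioi.2 (one_pos (α := ℝ))⟩
  obtain ⟨q, hq, hzq⟩ := hd.exists_mem_open isOpen_Iio
    ⟨-1, Set.mem_Iio.2 (neg_one_lt_zero (R := ℝ))⟩
  have hpq : ((p / |p| : ℝ) : ℂ) = ((q / |q| : ℝ) : ℂ) := hp.trans hq.symm
  rw [abs_of_pos hzp, abs_of_neg hzq, div_self hzp.ne', div_neg, div_self hzq.ne] at hpq
  norm_num at hpq

theorem inverse_limitOp_ne_smul_one {t c : ℝ} (ht : t ≠ 0) (hc : c ≠ 0) (z : ℂ) :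
    Ring.inverse (limitOp t c) ≠ z • (1 : H →L[ℂ] H) := by
  intro h
  have htC : (t : ℂ) ≠ 0 := by exact_mod_cast ht
  have hmul : z • limitOp t c = 1 := by
    rw [← Ring.inverse_mul_cancel _ (isUnit_limitOp t hc), h, smul_one_mul]
  have hz : z ≠ 0 := by
    rintro rfl
    exact zero_ne_one ((zero_smul ℂ _).symm.trans hmul)
  refine signP_ne_smul_one ((t : ℂ)⁻¹ * (z⁻¹ - Complex.I * c)) ?_
  rw [mul_smul, eq_inv_smul_iff₀ htC, sub_smul, eq_sub_iff_add_eq', eq_inv_smul_iff₀ hz]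
  exact hmul

end Momentum

section Dilation

/-! ### Dilation limits -/

/-- Conjugation `A ↦ D(δ) A D(δ)⁻¹` by a dilation, an automorphism of the bounded operators. -/
noncomputable def dilConj (δ : Set.Ioi (0 : ℝ)) : (H →L[ℂ] H) ≃⋆ₐ[ℂ] (H →L[ℂ] H) :=
  (dilation δ).conjStarAlgEquiv

theorem dilConj_apply (δ : Set.Ioi (0 : ℝ)) (A : H →L[ℂ] H) (φ : H) :
    dilConj δ A φ = dilation δ (A ((dilation δ).symm φ)) := rfl

theorem norm_dilConj (δ : Set.Ioi (0 : ℝ)) (A : H →L[ℂ] H) : ‖dilConj δ A‖ = ‖A‖ :=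
  StarAlgEquiv.norm_map (dilConj δ) A

theorem norm_dilConj_apply_le (δ : Set.Ioi (0 : ℝ)) (A : H →L[ℂ] H) (φ : H) :
    ‖dilConj δ A φ‖ ≤ ‖A‖ * ‖φ‖ :=
  ((dilConj δ A).le_opNorm φ).trans_eq (by rw [norm_dilConj])

theorem tendsto_dilConj_zero (A : H →L[ℂ] H) {y : Set.Ioi (0 : ℝ) → H}
    (hy : Tendsto y atTop (𝓝 0)) : Tendsto (fun δ => dilConj δ A (y δ)) atTop (𝓝 0) := by
  refine squeeze_zero_norm (fun δ => norm_dilConj_apply_le δ A (y δ)) ?_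
  simpa using hy.norm.const_mul ‖A‖

theorem tendsto_dilConj_iff {A : H →L[ℂ] H} {y : Set.Ioi (0 : ℝ) → H} {φ ψ : H}
    (hy : Tendsto y atTop (𝓝 φ)) :
    Tendsto (fun δ => dilConj δ A (y δ)) atTop (𝓝 ψ) ↔
      Tendsto (fun δ => dilConj δ A φ) atTop (𝓝 ψ) := by
  have h0 : Tendsto (fun δ => y δ - φ) atTop (𝓝 0) := tendsto_sub_nhds_zero_iff.2 hy
  have h := tendsto_dilConj_zero A h0
  simp only [map_sub] at h
  exact ⟨fun hl => by simpa using hl.sub h, fun hl => by simpa using h.add hl⟩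

theorem hasDilationLimit_of_denseRange {A B : H →L[ℂ] H} {β : Type*} {e : β → H}
    (he : DenseRange e) (h : ∀ b, Tendsto (fun δ => dilConj δ A (e b)) atTop (𝓝 (B (e b)))) :
    HasDilationLimit A B := by
  have hlip (δ : Set.Ioi (0 : ℝ)) : LipschitzWith ‖A‖₊ (dilConj δ A) :=
    (dilConj δ A).lipschitz.weaken (norm_dilConj δ A).le
  have hclosed := (LipschitzWith.uniformEquicontinuous _ _ hlip).equicontinuous
    |>.isClosed_setOfPred_tendsto (l := atTop) B.continuous
  exact fun φ => he.induction_on φ hclosed h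

variable {A B A' B' : H →L[ℂ] H}

theorem HasDilationLimit.add (h : HasDilationLimit A B) (h' : HasDilationLimit A' B') :
    HasDilationLimit (A + A') (B + B') := fun φ => by
  simpa using (h φ).add (h' φ)

theorem HasDilationLimit.sub (h : HasDilationLimit A B) (h' : HasDilationLimit A' B') :
    HasDilationLimit (A - A') (B - B') := fun φ => by
  simpa using (h φ).sub (h' φ)

theorem HasDilationLimit.mul (h : HasDilationLimit A B) (h' : HasDilationLimit A' B') :
    HasDilationLimit (A * A') (B * B') := fun φ => by
  have hmul := (tendsto_dilConj_iff (h' φ)).2 (h (B' φ))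
  simp only [dilConj_apply, LinearIsometryEquiv.symm_apply_apply] at hmul
  exact hmul

theorem hasDilationLimit_algebraMap (z : ℂ) :
    HasDilationLimit (algebraMap ℂ (H →L[ℂ] H) z) (algebraMap ℂ (H →L[ℂ] H) z) := fun φ => by
  simp [Algebra.algebraMap_eq_smul_one]

theorem HasDilationLimit.const_smul (h : HasDilationLimit A B) (z : ℂ) :
    HasDilationLimit (z • A) (z • B) := fun φ => by
  simpa using (h φ).const_smul z

theorem HasDilationLimit.norm_le (h : HasDilationLimit A B) : ‖B‖ ≤ ‖A‖ := by
  refine B.opNorm_le_bound (norm_nonneg A) fun φ => ?_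
  exact le_of_tendsto (h φ).norm (Eventually.of_forall fun δ => norm_dilConj_apply_le δ A φ)

theorem HasDilationLimit.unique (h : HasDilationLimit A B) (h' : HasDilationLimit A B') :
    B = B' :=
  ContinuousLinearMap.ext fun φ => tendsto_nhds_unique (h φ) (h' φ)

theorem HasDilationLimit.of_tendsto {α : Type*} {l : Filter α} [l.NeBot] {u v : α → H →L[ℂ] H}
    (h : ∀ i, HasDilationLimit (u i) (v i)) (hu : Tendsto u l (𝓝 A)) (hv : Tendsto v l (𝓝 B)) :
    HasDilationLimit A B := by
  intro φ
  have hunif : TendstoUniformly (fun i δ => dilConj δ (u i) φ) (fun δ => dilConj δ A φ) l := by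
    refine Metric.tendstoUniformly_iff.2 fun ε hε => ?_
    have hnorm : Tendsto (fun i => ‖A - u i‖ * ‖φ‖) l (𝓝 0) := by
      simpa using (hu.const_sub A).norm.mul_const ‖φ‖
    filter_upwards [hnorm.eventually_lt_const hε] with i hi δ
    rw [dist_eq_norm, ← sub_apply, ← map_sub]
    exact (norm_dilConj_apply_le δ _ φ).trans_lt hi
  exact hunif.tendsto_of_eventually_tendsto (Eventually.of_forall fun i => h i φ)
    ((continuous_eval_const φ).continuousAt.tendsto.comp hv)

/-- The bounded operators `A` for which `D(δ) A D(δ)⁻¹` has a scalar limit as `δ → ∞`. -/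
def scalarDilationLimits : Subalgebra ℂ (H →L[ℂ] H) where
  carrier := {A | ∃ z : ℂ, HasDilationLimit A (algebraMap ℂ _ z)}
  add_mem' := fun ⟨z, hz⟩ ⟨w, hw⟩ => ⟨z + w, by rw [map_add]; exact hz.add hw⟩
  mul_mem' := fun ⟨z, hz⟩ ⟨w, hw⟩ => ⟨z * w, by rw [map_mul]; exact hz.mul hw⟩
  algebraMap_mem' z := ⟨z, hasDilationLimit_algebraMap z⟩

theorem isClosed_scalarDilationLimits : IsClosed (scalarDilationLimits : Set (H →L[ℂ] H)) := by
  refine isSeqClosed_iff_isClosed.1 fun A L hA hL => ?_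
  choose z hz using hA
  have hdist (i j : ℕ) : dist (z i) (z j) ≤ dist (A i) (A j) := by
    have h := ((hz i).sub (hz j)).norm_le
    rwa [← map_sub, norm_algebraMap', ← dist_eq_norm, ← dist_eq_norm] at h
  have hcauchy : CauchySeq z := Metric.cauchySeq_iff.2 fun ε hε =>
    (Metric.cauchySeq_iff.1 hL.cauchySeq ε hε).imp fun N hN i hi j hj =>
      (hdist i j).trans_lt (hN i hi j hj)
  obtain ⟨w, hw⟩ := cauchySeq_tendsto_of_complete hcauchy
  exact ⟨w, .of_tendsto hz hL ((continuous_algebraMap ℂ _).continuousAt.tendsto.comp hw)⟩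

/-! ### Dilations of Schwartz functions -/

/-- The dilation `f ↦ δ^{-1/2} f(x / δ)` of Schwartz functions. -/
noncomputable def schwartzDilation (δ : Set.Ioi (0 : ℝ)) : 𝓢(ℝ, ℂ) →L[ℂ] 𝓢(ℝ, ℂ) :=
  (((Real.sqrt δ.1)⁻¹ : ℝ) : ℂ) • compCLMOfContinuousLinearEquiv ℂ
    (ContinuousLinearEquiv.unitsEquivAut ℝ (Units.mk0 (δ.1)⁻¹ (inv_pos.2 δ.2).ne'))

theorem schwartzDilation_apply (δ : Set.Ioi (0 : ℝ)) (f : 𝓢(ℝ, ℂ)) (x : ℝ) :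
    schwartzDilation δ f x = (((Real.sqrt δ.1)⁻¹ : ℝ) : ℂ) * f (δ.1⁻¹ * x) := by
  rw [mul_comm δ.1⁻¹]
  rfl

theorem dilation_ι (δ : Set.Ioi (0 : ℝ)) (f : 𝓢(ℝ, ℂ)) :
    dilation δ (ι f) = ι (schwartzDilation δ f) := by
  apply Lp.ext
  filter_upwards [coeFn_dilationLin δ (ι f), ae_dilation δ.2 (coeFn_ι f),
    coeFn_ι (schwartzDilation δ f)] with x h1 h2 h3
  exact h1.trans (by rw [h2, h3, schwartzDilation_apply])

/-- The parameter `δ⁻¹` of the inverse dilation. -/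
noncomputable def invIoi (δ : Set.Ioi (0 : ℝ)) : Set.Ioi (0 : ℝ) :=
  ⟨δ.1⁻¹, inv_pos.2 (show (0 : ℝ) < δ.1 from δ.2)⟩

theorem dilation_symm (δ : Set.Ioi (0 : ℝ)) (φ : H) :
    (dilation δ).symm φ = dilation (invIoi δ) φ := rfl

theorem schwartzQ_schwartzDilation (δ : Set.Ioi (0 : ℝ)) (f : 𝓢(ℝ, ℂ)) :
    schwartzQ (schwartzDilation δ f) = (δ.1 : ℂ) • schwartzDilation δ (schwartzQ f) := by
  have hδ : (δ.1 : ℂ) ≠ 0 := by exact_mod_cast (show (0 : ℝ) < δ.1 from δ.2).ne'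
  ext x
  rw [smul_apply, schwartzDilation_apply, smulLeftCLM_apply_apply (by fun_prop),
    smulLeftCLM_apply_apply (by fun_prop), schwartzDilation_apply]
  simp only [smul_eq_mul, Complex.ofReal_mul, Complex.ofReal_inv]
  field_simp

theorem schwartzP_schwartzDilation (δ : Set.Ioi (0 : ℝ)) (f : 𝓢(ℝ, ℂ)) :
    schwartzP (schwartzDilation δ f) = ((δ.1⁻¹ : ℝ) : ℂ) • schwartzDilation δ (schwartzP f) := by
  ext x
  have hscale : HasDerivAt (fun x : ℝ => δ.1⁻¹ * x) δ.1⁻¹ x := by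
    simpa using (hasDerivAt_id x).const_mul δ.1⁻¹
  have hderiv : HasDerivAt (schwartzDilation δ f)
      ((((Real.sqrt δ.1)⁻¹ : ℝ) : ℂ) * ((δ.1⁻¹ : ℝ) • deriv f (δ.1⁻¹ * x))) x :=
    ((HasDerivAt.scomp x (f.hasDerivAt (δ.1⁻¹ * x)) hscale).const_mul _).congr_of_eventuallyEq
      (Eventually.of_forall (schwartzDilation_apply δ f))
  have hP (h : 𝓢(ℝ, ℂ)) (y : ℝ) : schwartzP h y = -Complex.I * deriv h y := rfl
  rw [hP, smul_apply, schwartzDilation_apply, hP, hderiv.deriv, Complex.real_smul, smul_eq_mul]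
  ring

theorem fourier_schwartzDilation (δ : Set.Ioi (0 : ℝ)) (f : 𝓢(ℝ, ℂ)) :
    𝓕 (schwartzDilation δ f) = schwartzDilation (invIoi δ) (𝓕 f) := by
  have hδ : 0 < δ.1 := δ.2
  ext w
  have hsubst := Measure.integral_comp_inv_mul_left (fun v : ℝ =>
    Complex.exp (((-2 * Real.pi * v * (δ.1 * w) : ℝ) : ℂ) * Complex.I) • f v) δ.1
  have hsqrt : (Real.sqrt δ.1)⁻¹ * δ.1 = Real.sqrt δ.1 := by
    rw [inv_mul_eq_iff_eq_mul₀ (Real.sqrt_pos.2 hδ).ne', Real.mul_self_sqrt hδ.le]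
  rw [schwartzDilation_apply, SchwartzMap.fourier_coe, SchwartzMap.fourier_coe,
    Real.fourier_real_eq_integral_exp_smul, Real.fourier_real_eq_integral_exp_smul]
  calc ∫ v : ℝ, Complex.exp (((-2 * Real.pi * v * w : ℝ) : ℂ) * Complex.I) •
          schwartzDilation δ f v
      = (((Real.sqrt δ.1)⁻¹ : ℝ) : ℂ) * ∫ v : ℝ,
          Complex.exp (((-2 * Real.pi * (δ.1⁻¹ * v) * (δ.1 * w) : ℝ) : ℂ) * Complex.I) •
            f (δ.1⁻¹ * v) := by
        rw [← integral_const_mul]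
        refine integral_congr_ae (Eventually.of_forall fun v => ?_)
        beta_reduce
        rw [schwartzDilation_apply, smul_eq_mul, smul_eq_mul, mul_left_comm,
          show -2 * Real.pi * (δ.1⁻¹ * v) * (δ.1 * w) = -2 * Real.pi * v * w by field_simp]
    _ = ((Real.sqrt δ.1 : ℝ) : ℂ) * ∫ v : ℝ,
          Complex.exp (((-2 * Real.pi * v * (δ.1 * w) : ℝ) : ℂ) * Complex.I) • f v := by
        rw [hsubst, abs_of_pos hδ, Complex.real_smul, ← mul_assoc, ← Complex.ofReal_mul, hsqrt]
    _ = _ := by simp only [invIoi, Real.sqrt_inv, inv_inv]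

theorem fourier_dilation (δ : Set.Ioi (0 : ℝ)) (φ : H) :
    𝓕 (dilation δ φ) = dilation (invIoi δ) (𝓕 φ) := by
  refine denseRange_ι.induction_on (p := fun φ : H =>
    𝓕 (dilation δ φ) = dilation (invIoi δ) (𝓕 φ)) φ (isClosed_eq ?_ ?_) fun f => ?_
  · exact (Lp.fourierTransformₗᵢ ℝ ℂ).continuous.comp (dilation δ).continuous
  · exact (dilation _).continuous.comp (Lp.fourierTransformₗᵢ ℝ ℂ).continuous
  · rw [dilation_ι, fourier_ι, fourier_ι, dilation_ι, fourier_schwartzDilation]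

theorem dilConj_funP {g : ℝ → ℂ} (hg : Measurable g) {C : ℝ} (hC : ∀ p, ‖g p‖ ≤ C)
    (δ : Set.Ioi (0 : ℝ)) :
    dilConj δ (funP g hg hC) =
      funP (fun p => g (δ.1 * p)) (hg.comp (measurable_const_mul _)) (fun p => hC _) := by
  ext1 φ
  obtain ⟨ψ, rfl⟩ := (dilation δ).surjective φ
  apply eq_of_fourier_ae_eq
  rw [dilConj_apply, LinearIsometryEquiv.symm_apply_apply, fourier_dilation]
  filter_upwards [coeFn_dilationLin (invIoi δ) (𝓕 (funP g hg hC ψ)),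
    coeFn_dilationLin (invIoi δ) (𝓕 ψ), ae_dilation (invIoi δ).2 (coeFn_fourier_funP hg hC ψ),
    coeFn_fourier_funP (g := fun p => g (δ.1 * p)) (hg.comp (measurable_const_mul _))
      (fun p => hC _) (dilation δ ψ)] with ξ h1 h2 h3 h4
  have hscale : 2 * Real.pi * ((invIoi δ).1⁻¹ * ξ) = δ.1 * (2 * Real.pi * ξ) := by
    simp only [invIoi, inv_inv]
    ring
  rw [h4, fourier_dilation]
  exact h1.trans (by rw [h3, hscale, mul_left_comm]; exact congrArg _ h2.symm)

end Dilation

section ResolventLimits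

/-! ### Dilation limits of resolvents -/

theorem tendsto_inv_dilation :
    Tendsto (fun δ : Set.Ioi (0 : ℝ) => ((δ.1⁻¹ : ℝ) : ℂ)) atTop (𝓝 0) :=
  (Complex.continuous_ofReal.tendsto' 0 0 Complex.ofReal_zero).comp
    (tendsto_comp_val_Ioi_atTop.2 tendsto_inv_atTop_zero)

theorem dilation_symm_ι (δ : Set.Ioi (0 : ℝ)) (f : 𝓢(ℝ, ℂ)) :
    (dilation δ).symm (ι f) = ι (schwartzDilation (invIoi δ) f) := by
  rw [dilation_symm, dilation_ι]

theorem dilation_symm_ι_schwartzQ (δ : Set.Ioi (0 : ℝ)) (f : 𝓢(ℝ, ℂ)) :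
    ((δ.1⁻¹ : ℝ) : ℂ) • (dilation δ).symm (ι (schwartzQ f)) =
      ι (schwartzQ (schwartzDilation (invIoi δ) f)) := by
  rw [schwartzQ_schwartzDilation, map_smul, dilation_symm_ι]
  rfl

theorem dilation_symm_ι_schwartzP (δ : Set.Ioi (0 : ℝ)) (f : 𝓢(ℝ, ℂ)) :
    (δ.1 : ℂ) • (dilation δ).symm (ι (schwartzP f)) =
      ι (schwartzP (schwartzDilation (invIoi δ) f)) := by
  rw [schwartzP_schwartzDilation, map_smul, dilation_symm_ι, invIoi, inv_inv]

theorem denseRange_schwartzP : DenseRange fun f => ι (schwartzP f) := by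
  let u (ε p : ℝ) : ℂ := p * (Complex.I * ε + p)⁻¹
  have hu (ε : ℝ) : Measurable (u ε) := by fun_prop
  have hC (ε p : ℝ) : ‖u ε p‖ ≤ 1 := by
    rw [norm_mul, norm_inv, ← div_eq_mul_inv, Complex.norm_real, Real.norm_eq_abs]
    refine div_le_one_of_le₀ ?_ (norm_nonneg _)
    simpa using Complex.abs_re_le_norm (Complex.I * ε + p)
  have hlim : ∀ᵐ p, Tendsto (u · p) (𝓝[≠] 0) (𝓝 1) := by
    filter_upwards [Measure.ae_ne volume (0 : ℝ)] with p hp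
    have hp' : (p : ℂ) ≠ 0 := by exact_mod_cast hp
    have hcont : ContinuousAt (u · p) 0 := by
      refine ContinuousAt.mul continuousAt_const (ContinuousAt.inv₀ (by fun_prop) ?_)
      simpa using hp
    simpa [u, hp'] using hcont.tendsto.mono_left nhdsWithin_le_nhds
  have hone : funP (fun _ => 1) measurable_const (fun _ => norm_one.le) = 1 := by
    rw [← one_smul ℂ (1 : H →L[ℂ] H), funP_eq_smul_one_iff]
    exact Eventually.of_forall fun _ => rfl
  refine dense_closure.1 (denseRange_ι.mono ?_)
  rintro _ ⟨f, rfl⟩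
  have hf := tendsto_funP hu hC measurable_const (fun _ => norm_one.le) hlim (ι f)
  rw [hone, one_apply_eq_self] at hf
  refine mem_closure_of_tendsto hf ?_
  filter_upwards [self_mem_nhdsWithin] with ε hε
  have hinv := hasTemperateGrowth_inv_I_mul_add hε
  have hid := Function.Complex.hasTemperateGrowth_ofReal
  refine ⟨schwartzFunP (fun p => (Complex.I * ε + p)⁻¹) f, ?_⟩
  beta_reduce
  rw [funP_ι (hu ε) (hC ε) (hid.mul hinv), ← schwartzFunP_ofReal,
    schwartzFunP_schwartzFunP hid hinv]

variable {c : ℝ}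

theorem hasDilationLimit_basicResolvent_of_ne {a : ℝ} (hc : c ≠ 0) (ha : a ≠ 0) (b : ℝ) :
    HasDilationLimit (basicResolvent a b c) 0 := by
  refine hasDilationLimit_of_denseRange denseRange_schwartzP fun f => ?_
  have haC : (a : ℂ) ≠ 0 := by exact_mod_cast ha
  let s (δ : Set.Ioi (0 : ℝ)) : ℂ := (a : ℂ)⁻¹ * ((δ.1⁻¹ : ℝ) : ℂ)
  have hs : Tendsto s atTop (𝓝 0) := by
    simpa only [mul_zero] using tendsto_inv_dilation.const_mul (a : ℂ)⁻¹
  let y (δ : Set.Ioi (0 : ℝ)) : H := s δ • ((Complex.I * (c : ℂ)) • ι f +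
    ((b : ℂ) * ((δ.1⁻¹ : ℝ) : ℂ)) • ι (schwartzQ f)) + ι (schwartzP f)
  have hy : Tendsto y atTop (𝓝 (ι (schwartzP f))) := by
    simpa only [zero_smul, zero_add] using
      (hs.smul (((tendsto_inv_dilation.const_mul (b : ℂ)).smul_const
        (ι (schwartzQ f))).const_add ((Complex.I * (c : ℂ)) • ι f))).add_const (ι (schwartzP f))
  have hRy (δ : Set.Ioi (0 : ℝ)) : dilConj δ (basicResolvent a b c) (y δ) = s δ • ι f := by
    have hδ : (δ.1 : ℂ) ≠ 0 := by exact_mod_cast (show (0 : ℝ) < δ.1 from δ.2).ne'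
    have hsδ : s δ * (a * δ.1) = 1 := by
      rw [show s δ = (a : ℂ)⁻¹ * ((δ.1⁻¹ : ℝ) : ℂ) from rfl, Complex.ofReal_inv]
      field_simp
    let g := schwartzDilation (invIoi δ) f
    have hyδ : (dilation δ).symm (y δ) =
        s δ • ι ((Complex.I * (c : ℂ)) • g + schwartzLinComb a b g) := by
      have hg : ι ((Complex.I * (c : ℂ)) • g + schwartzLinComb a b g) =
          (Complex.I * (c : ℂ)) • ι g + ((a : ℂ) • ι (schwartzP g) + (b : ℂ) • ι (schwartzQ g)) :=
        rfl
      rw [hg, ← dilation_symm_ι, ← dilation_symm_ι_schwartzP, ← dilation_symm_ι_schwartzQ]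
      simp only [y, map_add, map_smul]
      linear_combination (norm := module) (-hsδ) • (dilation δ).symm (ι (schwartzP f))
    rw [dilConj_apply, hyδ, map_smul, basicResolvent_apply hc, map_smul, ← dilation_symm_ι,
      LinearIsometryEquiv.apply_symm_apply]
  rw [← tendsto_dilConj_iff hy, zero_apply]
  simpa only [hRy, zero_smul] using hs.smul_const (ι f)

theorem hasDilationLimit_of_inverse {R V L K : H →L[ℂ] H} {z : ℂ} {b : ℝ}
    (hR : ∀ f, R (z • ι f + (b : ℂ) • ι (schwartzQ f) + V (ι f)) = ι f)
    (hV : HasDilationLimit V L) (hleft : K * (z • 1 + L) = 1) (hright : (z • 1 + L) * K = 1) :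
    HasDilationLimit R K := by
  let X : H →L[ℂ] H := z • 1 + L
  have hX : Function.Surjective X := fun φ => ⟨K φ, congr($hright φ)⟩
  refine hasDilationLimit_of_denseRange (hX.denseRange.comp denseRange_ι X.continuous) fun f => ?_
  let y (δ : Set.Ioi (0 : ℝ)) : H := z • ι f +
    ((b : ℂ) * ((δ.1⁻¹ : ℝ) : ℂ)) • ι (schwartzQ f) + dilConj δ V (ι f)
  have hy : Tendsto y atTop (𝓝 (X (ι f))) := by
    have h := (((tendsto_inv_dilation.const_mul (b : ℂ)).smul_const
      (ι (schwartzQ f))).const_add (z • ι f)).add (hV (ι f))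
    simp only [mul_zero, zero_smul, add_zero] at h
    exact h
  have hRy (δ : Set.Ioi (0 : ℝ)) : dilConj δ R (y δ) = ι f := by
    let g := schwartzDilation (invIoi δ) f
    have hyδ : (dilation δ).symm (y δ) =
        z • ι g + (b : ℂ) • ι (schwartzQ g) + V (ι g) := by
      simp only [y, g, map_add, map_smul, mul_smul, dilConj_apply, ← dilation_symm_ι_schwartzQ,
        ← dilation_symm_ι, LinearIsometryEquiv.symm_apply_apply]
    rw [dilConj_apply, hyδ, hR, ← dilation_symm_ι, LinearIsometryEquiv.apply_symm_apply]
  rw [show K ((X ∘ ι) f) = ι f from congr($hleft (ι f)), Function.comp_apply,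
    ← tendsto_dilConj_iff hy]
  simpa only [hRy] using tendsto_const_nhds

theorem hasDilationLimit_basicResolvent_zero (hc : c ≠ 0) (b : ℝ) :
    HasDilationLimit (basicResolvent 0 b c) ((Complex.I * (c : ℂ))⁻¹ • (1 : H →L[ℂ] H)) := by
  have hc' : Complex.I * (c : ℂ) ≠ 0 := by simp [hc]
  have h0 : HasDilationLimit 0 0 := fun φ => by simp
  refine hasDilationLimit_of_inverse (z := Complex.I * c) (b := b) (fun f => ?_) h0 ?_ ?_
  · have h := basicResolvent_apply hc 0 b f
    rw [schwartzLinComb_apply, Complex.ofReal_zero, zero_smul, zero_add, map_add, map_smul,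
      map_smul] at h
    rwa [zero_apply, add_zero]
  · rw [add_zero, smul_mul_smul_comm, inv_mul_cancel₀ hc', one_smul, mul_one]
  · rw [add_zero, smul_mul_smul_comm, mul_inv_cancel₀ hc', one_smul, mul_one]

theorem resolventAlgebra_subset_scalarDilationLimits :
    (resolventAlgebra : Set (H →L[ℂ] H)) ⊆ scalarDilationLimits := by
  have hgen {a b c : ℝ} (hc : c ≠ 0) : basicResolvent a b c ∈ scalarDilationLimits := by
    rcases eq_or_ne a 0 with rfl | ha
    · exact ⟨_, by simpa only [Algebra.algebraMap_eq_smul_one] using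
        hasDilationLimit_basicResolvent_zero hc b⟩
    · exact ⟨0, by simpa only [map_zero] using hasDilationLimit_basicResolvent_of_ne hc ha b⟩
  refine closure_minimal ?_ isClosed_scalarDilationLimits
  rw [← StarSubalgebra.coe_toSubalgebra, StarAlgebra.adjoin_toSubalgebra]
  refine Algebra.adjoin_le (Set.union_subset ?_ ?_)
  · rintro _ ⟨a, b, c, hc, rfl⟩
    exact hgen hc
  · rintro A ⟨a, b, c, hc, hA⟩
    rw [← star_star A, hA, star_basicResolvent hc]
    exact hgen (neg_ne_zero.2 hc)

theorem exists_hasDilationLimit_of_mem {A : H →L[ℂ] H} (hA : A ∈ resolventAlgebra) :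
    ∃ z : ℂ, HasDilationLimit A (z • (1 : H →L[ℂ] H)) := by
  obtain ⟨z, hz⟩ := resolventAlgebra_subset_scalarDilationLimits hA
  exact ⟨z, by rwa [← Algebra.algebraMap_eq_smul_one]⟩

theorem tendsto_velocity (m p : ℝ) :
    Tendsto (fun δ : Set.Ioi (0 : ℝ) =>
      ((δ.1 * p / Real.sqrt ((δ.1 * p) ^ 2 + m ^ 2) : ℝ) : ℂ)) atTop
      (𝓝 ((p / |p| : ℝ) : ℂ)) := by
  refine (Complex.continuous_ofReal.tendsto _).comp ?_
  rcases eq_or_ne p 0 with rfl | hp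
  · simp
  have hcont : ContinuousAt (fun ε : ℝ => p / Real.sqrt (p ^ 2 + (m * ε) ^ 2)) 0 :=
    ContinuousAt.div continuousAt_const (by fun_prop) (by simp [Real.sqrt_sq_eq_abs, hp])
  have hinv : Tendsto (fun δ : Set.Ioi (0 : ℝ) => δ.1⁻¹) atTop (𝓝 0) :=
    tendsto_comp_val_Ioi_atTop.2 tendsto_inv_atTop_zero
  have hlim := hcont.tendsto.comp hinv
  rw [mul_zero, zero_pow two_ne_zero, add_zero, Real.sqrt_sq_eq_abs] at hlim
  refine hlim.congr fun δ => ?_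
  have hδ : 0 < δ.1 := δ.2
  have hscale : (δ.1 * p) ^ 2 + m ^ 2 = δ.1 ^ 2 * (p ^ 2 + (m * δ.1⁻¹) ^ 2) := by
    field_simp
  rw [hscale, Real.sqrt_mul (sq_nonneg _), Real.sqrt_sq hδ.le, mul_div_mul_left _ _ hδ.ne']
  rfl

theorem hasDilationLimit_velocity (m : ℝ) : HasDilationLimit (velocity m) signP := fun φ => by
  have : (atTop : Filter (Set.Ioi (0 : ℝ))).IsCountablyGenerated := by
    rw [atTop_Ioi_eq]
    infer_instance
  have h := tendsto_funP (fun δ : Set.Ioi (0 : ℝ) => by fun_prop)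
    (fun δ p => norm_velocity_le m (δ.1 * p)) (by fun_prop) norm_signum_le
    (Eventually.of_forall (tendsto_velocity m)) φ
  refine h.congr fun δ => ?_
  rw [← dilConj_funP (g := fun p => ((p / Real.sqrt (p ^ 2 + m ^ 2) : ℝ) : ℂ)) (by fun_prop)
    (norm_velocity_le m) δ]
  rfl

end ResolventLimits

section Evolution

/-! ### The relativistic evolution -/

/-- The symbol `p ↦ p / √(p² + m²)` of the relativistic velocity. -/
noncomputable def velocitySymbol (m p : ℝ) : ℂ := (p / Real.sqrt (p ^ 2 + m ^ 2) : ℝ)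

/-- The symbol `p ↦ e^{i t √(p² + m²)}` of the relativistic evolution. -/
noncomputable def evolutionSymbol (m t p : ℝ) : ℂ :=
  Complex.exp (((t * Real.sqrt (p ^ 2 + m ^ 2) : ℝ) : ℂ) * Complex.I)

theorem relEvolution_mul (m s t : ℝ) :
    relEvolution m s * relEvolution m t = relEvolution m (s + t) :=
  funP_mul_funP _ _ _ _ _ _ fun p => by
    rw [← Complex.exp_add, ← add_mul, ← Complex.ofReal_add, ← add_mul]

theorem relEvolution_zero (m : ℝ) : relEvolution m 0 = 1 := by
  rw [← one_smul ℂ (1 : H →L[ℂ] H), relEvolution, funP_eq_smul_one_iff]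
  exact Eventually.of_forall fun p => by simp

variable {m : ℝ}

theorem hasTemperateGrowth_velocitySymbol (hm : m ≠ 0) :
    (velocitySymbol m).HasTemperateGrowth :=
  Function.Complex.hasTemperateGrowth_ofReal.comp (hasTemperateGrowth_div_sqrt_sq_add_sq hm)

theorem hasTemperateGrowth_evolutionSymbol (hm : m ≠ 0) (t : ℝ) :
    (evolutionSymbol m t).HasTemperateGrowth :=
  hasTemperateGrowth_phase
    ((Function.HasTemperateGrowth.const t).mul (hasTemperateGrowth_sqrt_sq_add_sq hm))

theorem hasDerivAt_evolutionSymbol (hm : m ≠ 0) (t p : ℝ) :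
    HasDerivAt (evolutionSymbol m t)
      (Complex.I * t * velocitySymbol m p * evolutionSymbol m t p) p := by
  have hpos : p ^ 2 + m ^ 2 ≠ 0 := by positivity
  have hsqrt : HasDerivAt (fun p : ℝ => Real.sqrt (p ^ 2 + m ^ 2))
      (p / Real.sqrt (p ^ 2 + m ^ 2)) p := by
    convert! (((hasDerivAt_id p).pow 2).add_const (m ^ 2)).sqrt hpos using 1
    rw [id, Nat.cast_two, pow_one, mul_one, mul_div_mul_left _ _ two_ne_zero]
    rfl
  convert! ((hsqrt.const_mul t).ofReal_comp.mul_const Complex.I).cexp using 1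
  simp only [velocitySymbol, evolutionSymbol, Complex.ofReal_mul]
  ring

theorem velocity_ι (hm : m ≠ 0) (f : 𝓢(ℝ, ℂ)) :
    velocity m (ι f) = ι (schwartzFunP (velocitySymbol m) f) :=
  funP_ι _ _ (hasTemperateGrowth_velocitySymbol hm) f

theorem relEvolution_ι (hm : m ≠ 0) (t : ℝ) (f : 𝓢(ℝ, ℂ)) :
    relEvolution m t (ι f) = ι (schwartzFunP (evolutionSymbol m t) f) :=
  funP_ι _ _ (hasTemperateGrowth_evolutionSymbol hm t) f

/-! ### The evolved resolvent -/

/-- The operator `Q + t P (P² + m²)^{-1/2}` on the Schwartz space. -/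
noncomputable def schwartzBoostedQ (m t : ℝ) : 𝓢(ℝ, ℂ) →L[ℂ] 𝓢(ℝ, ℂ) :=
  (t : ℂ) • schwartzFunP (velocitySymbol m) + schwartzQ

theorem ι_schwartzBoostedQ (hm : m ≠ 0) (t : ℝ) (f : 𝓢(ℝ, ℂ)) :
    ι (schwartzBoostedQ m t f) = (t : ℂ) • velocity m (ι f) + ι (schwartzQ f) := by
  rw [velocity_ι hm]
  rfl

theorem boostedQ_eq_onSchwartz (hm : m ≠ 0) (t : ℝ) :
    boostedQ m t = onSchwartz (schwartzBoostedQ m t) := by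
  refine eq_onSchwartz rfl fun f hf => ?_
  rw [ι_schwartzBoostedQ hm, ← onSchwartz_apply schwartzQ f hf]
  rfl

theorem inner_ι_schwartzBoostedQ (hm : m ≠ 0) (t : ℝ) (f g : 𝓢(ℝ, ℂ)) :
    inner ℂ (ι (schwartzBoostedQ m t f)) (ι g) = inner ℂ (ι f) (ι (schwartzBoostedQ m t g)) := by
  have hV : inner ℂ (velocity m (ι f)) (ι g) = inner ℂ (ι f) (velocity m (ι g)) :=
    (isSelfAdjoint_funP _ _).isSymmetric (ι f) (ι g)
  rw [ι_schwartzBoostedQ hm, ι_schwartzBoostedQ hm, inner_add_left, inner_add_right,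
    inner_smul_left, inner_smul_right, Complex.conj_ofReal, hV, inner_ι_schwartzQ]

/-- The evolution carries the position operator to the boosted one because it shifts `Q = i d/dp`
by the derivative of its phase. -/
theorem schwartzBoostedQ_schwartzFunP (hm : m ≠ 0) (t : ℝ) (f : 𝓢(ℝ, ℂ)) :
    schwartzBoostedQ m t (schwartzFunP (evolutionSymbol m t) f) =
      schwartzFunP (evolutionSymbol m t) (schwartzQ f) := by
  have hu := hasTemperateGrowth_evolutionSymbol hm t
  have hv := hasTemperateGrowth_velocitySymbol hm
  have hz : Function.HasTemperateGrowth fun _ : ℝ => Complex.I * (t : ℂ) := .const _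
  have hcomm := schwartzQ_schwartzFunP hu ((hz.mul hv).mul hu) (hasDerivAt_evolutionSymbol hm t) f
  have hsplit : schwartzFunP ((fun _ => Complex.I * (t : ℂ)) * velocitySymbol m *
      evolutionSymbol m t) f = (Complex.I * (t : ℂ)) •
        schwartzFunP (velocitySymbol m) (schwartzFunP (evolutionSymbol m t) f) := by
    rw [← schwartzFunP_const, schwartzFunP_schwartzFunP hv hu, mul_assoc]
    exact (schwartzFunP_schwartzFunP hz (hv.mul hu) f).symm
  rw [schwartzBoostedQ, add_apply, smul_apply, hcomm, hsplit, smul_smul, ← mul_assoc,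
    Complex.I_mul_I]
  module

theorem schwartzFunP_evolutionSymbol_neg (hm : m ≠ 0) (t : ℝ) (f : 𝓢(ℝ, ℂ)) :
    schwartzFunP (evolutionSymbol m t) (schwartzFunP (evolutionSymbol m (-t)) f) = f := by
  have hone : (fun p => evolutionSymbol m t p * evolutionSymbol m (-t) p) = fun _ => 1 := by
    ext p
    rw [evolutionSymbol, evolutionSymbol, ← Complex.exp_add]
    simp
  rw [schwartzFunP_schwartzFunP (hasTemperateGrowth_evolutionSymbol hm t)
    (hasTemperateGrowth_evolutionSymbol hm (-t)), hone, schwartzFunP_const, one_smul]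

variable {c : ℝ}

theorem surjective_I_smul_add_schwartzBoostedQ (hm : m ≠ 0) (hc : c ≠ 0) (t : ℝ) :
    Function.Surjective fun f => (Complex.I * (c : ℂ)) • f + schwartzBoostedQ m t f := by
  intro h
  obtain ⟨g, hg⟩ := surjective_I_smul_add_smul_schwartzQ hc 1
    (schwartzFunP (evolutionSymbol m (-t)) h)
  refine ⟨schwartzFunP (evolutionSymbol m t) g, ?_⟩
  dsimp only at hg ⊢
  rw [Complex.ofReal_one, one_smul] at hg
  rw [schwartzBoostedQ_schwartzFunP hm, ← map_smul, ← map_add, hg,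
    schwartzFunP_evolutionSymbol_neg hm]

theorem isBoundedInverse_evolvedResolvent (hm : m ≠ 0) (hc : c ≠ 0) (t : ℝ) :
    IsBoundedInverse (shiftedClosure c (boostedQ m t)) (evolvedResolvent m t c) := by
  rw [evolvedResolvent, boostedQ_eq_onSchwartz hm]
  exact isBoundedInverse_onSchwartz hc (inner_ι_schwartzBoostedQ hm t)
    (surjective_I_smul_add_schwartzBoostedQ hm hc t)

theorem evolvedResolvent_apply (hm : m ≠ 0) (hc : c ≠ 0) (t : ℝ) (f : 𝓢(ℝ, ℂ)) :
    evolvedResolvent m t c (ι ((Complex.I * (c : ℂ)) • f + schwartzBoostedQ m t f)) = ι f := by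
  have h := isBoundedInverse_evolvedResolvent hm hc t
  rw [boostedQ_eq_onSchwartz hm] at h
  exact h.apply_onSchwartz f

theorem relEvolution_mul_basicResolvent (hm : m ≠ 0) (hc : c ≠ 0) (t : ℝ) :
    relEvolution m t * basicResolvent 0 1 c = evolvedResolvent m t c * relEvolution m t := by
  refine DFunLike.coe_injective (denseRange_ι.equalizer (ContinuousLinearMap.continuous _)
    (ContinuousLinearMap.continuous _) (funext fun h => ?_))
  obtain ⟨f, rfl⟩ := surjective_I_smul_add_schwartzLinComb hc 0 1 h
  have hQ : schwartzLinComb 0 1 f = schwartzQ f := by simp [schwartzLinComb_apply]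
  calc relEvolution m t (basicResolvent 0 1 c (ι ((Complex.I * c) • f + schwartzLinComb 0 1 f)))
      = ι (schwartzFunP (evolutionSymbol m t) f) := by
        rw [basicResolvent_apply hc, relEvolution_ι hm]
    _ = evolvedResolvent m t c (relEvolution m t
          (ι ((Complex.I * c) • f + schwartzLinComb 0 1 f))) := by
        rw [hQ, relEvolution_ι hm, map_add (schwartzFunP _), map_smul (schwartzFunP _),
          ← schwartzBoostedQ_schwartzFunP hm, evolvedResolvent_apply hm hc]

theorem relEvolution_conj_basicResolvent (hm : m ≠ 0) (hc : c ≠ 0) (t : ℝ) :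
    relEvolution m t * basicResolvent 0 1 c * relEvolution m (-t) = evolvedResolvent m t c := by
  rw [relEvolution_mul_basicResolvent hm hc, mul_assoc, relEvolution_mul, add_neg_cancel,
    relEvolution_zero, mul_one]

theorem hasDilationLimit_evolvedResolvent (hm : m ≠ 0) (hc : c ≠ 0) (t : ℝ) :
    HasDilationLimit (evolvedResolvent m t c) (Ring.inverse (limitOp t c)) := by
  have hunit := isUnit_limitOp t hc
  refine hasDilationLimit_of_inverse (z := Complex.I * c) (b := 1) (fun f => ?_)
    ((hasDilationLimit_velocity m).const_smul (t : ℂ)) (Ring.inverse_mul_cancel _ hunit)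
    (Ring.mul_inverse_cancel _ hunit)
  have h := evolvedResolvent_apply hm hc t f
  rwa [map_add ι, map_smul ι, ι_schwartzBoostedQ hm, add_comm (_ • _) (ι (schwartzQ f)),
    ← add_assoc, ← one_smul ℂ (ι (schwartzQ f)), ← Complex.ofReal_one] at h

theorem evolvedResolvent_notMem {t : ℝ} (hm : m ≠ 0) (ht : t ≠ 0) (hc : c ≠ 0) :
    evolvedResolvent m t c ∉ resolventAlgebra := fun h => by
  obtain ⟨z, hz⟩ := exists_hasDilationLimit_of_mem h
  exact inverse_limitOp_ne_smul_one ht hc z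
    ((hasDilationLimit_evolvedResolvent hm hc t).unique hz)

end Evolution

end ResolventAlgebra

theorem lemma6p5 :
    -- dilation limits of the basic resolvents
    (∀ a b c : ℝ, c ≠ 0 →
      IsBoundedInverse (shiftedClosure c (linComb a b)) (basicResolvent a b c) ∧
      HasDilationLimit (basicResolvent a b c)
        (if a = 0 then (Complex.I * (c : ℂ))⁻¹ • (1 : H →L[ℂ] H) else 0)) ∧
    -- all elements of the resolvent algebra have scalar dilation limits
    (∀ A ∈ resolventAlgebra, ∃ z : ℂ, HasDilationLimit A (z • (1 : H →L[ℂ] H))) ∧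
    -- the dilation limit of the evolved resolvent of the position operator
    (∀ m t c : ℝ, 0 < m → c ≠ 0 →
      IsBoundedInverse (shiftedClosure c (boostedQ m t)) (evolvedResolvent m t c) ∧
      IsUnit (limitOp t c) ∧
      HasDilationLimit (evolvedResolvent m t c) (Ring.inverse (limitOp t c))) ∧
    -- this limit is not a scalar
    (∀ t c : ℝ, t ≠ 0 → c ≠ 0 → ∀ z : ℂ, Ring.inverse (limitOp t c) ≠ z • (1 : H →L[ℂ] H)) ∧
    -- the evolved resolvent leaves the resolvent algebra
    (∀ m t c : ℝ, 0 < m → c ≠ 0 →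
      relEvolution m t * basicResolvent 0 1 c * relEvolution m (-t) = evolvedResolvent m t c ∧
      (t ≠ 0 → evolvedResolvent m t c ∉ resolventAlgebra)) ∧
    -- the relativistic evolution does not leave the resolvent algebra invariant
    (∀ m t : ℝ, 0 < m → t ≠ 0 →
      ¬ ∀ A ∈ resolventAlgebra, relEvolution m t * A * relEvolution m (-t) ∈ resolventAlgebra) := by
  refine ⟨fun a b c hc => ⟨isBoundedInverse_basicResolvent hc a b, ?_⟩,
    fun A => exists_hasDilationLimit_of_mem,
    fun m t c hm hc => ⟨isBoundedInverse_evolvedResolvent hm.ne' hc t, isUnit_limitOp t hc,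
      hasDilationLimit_evolvedResolvent hm.ne' hc t⟩,
    fun t c => inverse_limitOp_ne_smul_one,
    fun m t c hm hc => ⟨relEvolution_conj_basicResolvent hm.ne' hc t,
      fun ht => evolvedResolvent_notMem hm.ne' ht hc⟩,
    fun m t hm ht h => ?_⟩
  · split_ifs with ha
    · subst ha
      exact hasDilationLimit_basicResolvent_zero hc b
    · exact hasDilationLimit_basicResolvent_of_ne hc ha b
  · refine evolvedResolvent_notMem hm.ne' ht one_ne_zero ?_
    rw [← relEvolution_conj_basicResolvent hm.ne' one_ne_zero t]
    exact h _ (basicResolvent_mem one_ne_zero 0 1)
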